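/- **Conventions.** In a partially ordered commutative monoid write $s\ll t$ if, whenever $(z_n)$ is an increasing sequence that has a supremum and $t\le\sup_n z_n$, there is $m$ with $s\le z_m$; a sequence is rapidly increasing if $z_n\ll z_{n+1}$ for all $n$. The category $\mathrm{Cu}$ has as objects the partially ordered commutative monoids with translation invariant order and least element $0$ in which every increasing sequence has a supremum, every element is the supremum of a rapidly increasing sequence, and suprema of increasing sequences and $\ll$ are compatible with addition. Its morphisms are the maps preserving addition, $0$, order, suprema of increasing sequences and $\ll$. An object is countably based if it has a countable subset $B$ such that every element is the supremum of a rapidly increasing sequence in $B$. Let $X$ be a non-empty, compact, Hausdorff, second countable space and let $\mathcal V_X$ be the set of closed subsets of $X$ with non-empty interior, ordered by inclusion. A presheaf $\mathcal S\colon\mathcal V_X\to\mathrm{Cu}$ is a contravariant functor. It is surjective if all restriction maps are surjective; continuous if $\mathcal S(V)=\varinjlim\mathcal S(V_n)$ in $\mathrm{Cu}$ (via the restriction maps) for each decreasing sequence $(V_n)$ in $\mathcal V_X$ with $V=\bigcap_n V_n\in\mathcal V_X$; and a sheaf if, whenever $V,W,V\cap W\in\mathcal V_X$, restriction is a bijection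 from $\mathcal S(V\cup W)$ onto the pairs in $\mathcal S(V)\times\mathcal S(W)$ that agree in $\mathcal S(V\cap W)$. Put $S=\mathcal S(X)$, let $S_x=\varinjlim_{x\in\mathring V}\mathcal S(V)$ (limit in $\mathrm{Cu}$) be the fiber at $x\in X$ and $\pi_x\colon S\to S_x$ the natural map, and write $\hat s(x)=\pi_x(s)$ for $s\in S$. Equip $F_S=\bigsqcup_{x\in X}S_x$ with the topology generated by the sets $$U_s^{\gg}=\{a\in S_x\mid x\in U,\ \hat{s'}(x)\ll a\text{ for some }s'\in S\text{ with }s\ll s'\},\qquad U\subseteq X\text{ open},\ s\in S,$$ and let $\Gamma(X,F_S)$ be the set of continuous maps $f\colon X\to F_S$ with $f(x)\in S_x$ for all $x$. A section $g$ is piecewise characteristic if there are a finite open cover $(U_i)_{i=1}^n$ of $X$ such that $(U_i)$ and $(\overline{U_i})$ both have multiplicity at most two and $\partial(\overline{U_i})$ has dimension at most $0$ for all $i$, and elements $s_i, s_{\{i,j\}}\in S$ ($i\ne j$) with $\hat s_i(x)\le\hat s_{\{i,j\}}(x)$ for all $x\in\overline{\partial(U_i\cap U_j)\cap U_i}$,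 such that $g=\hat s_i$ on $U_i\setminus\bigcup_{j\neq i}U_j$ and $g=\hat s_{\{i,j\}}$ on $U_i\cap U_j$. **Theorem.** Let $X$ be a non-empty, second countable, compact Hausdorff space of dimension at most one, and let $\mathcal S\colon\mathcal V_X\to\mathrm{Cu}$ be a surjective continuous sheaf such that $S=\mathcal S(X)$ is countably based. Then $\Gamma(X,F_S)$ contains the zero section and is closed under pointwise addition, and with pointwise addition and order it is an object of the category $\mathrm{Cu}$. Moreover, every $f\in\Gamma(X,F_S)$ is the supremum in $\Gamma(X,F_S)$ of a rapidly increasing sequence of piecewise characteristic sections $g_n\in\Gamma(X,F_S)$ with $g_n\ll f$. -/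

import Mathlib

universe u v w

namespace CuSheaf

/-! ## The category `Cu` -/

/-- Compact containment `s ≪ t`: whenever `t ≤ sup zₙ` for an increasing sequence `(zₙ)` that has
a supremum, there is `m` with `s ≤ zₘ`. -/
def CompactlyContained {S : Type*} [Preorder S] (s t : S) : Prop :=
  ∀ z : ℕ → S, Monotone z → ∀ b, IsLUB (Set.range z) b → t ≤ b → ∃ m, s ≤ z m

infix:50 " ≪ " => CompactlyContained

/-- A rapidly increasing sequence. -/
def RapidlyIncreasing {S : Type*} [Preorder S] (u : ℕ → S) : Prop := ∀ n, u n ≪ u (n + 1)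

/-- The ordered semigroup `S` is an object of the category `Cu`. -/
class IsCu (S : Type*) [AddCommMonoid S] [PartialOrder S] : Prop where
  zero_le : ∀ a : S, 0 ≤ a
  add_le_add_right : ∀ a b c : S, a ≤ b → a + c ≤ b + c
  exists_isLUB : ∀ z : ℕ → S, Monotone z → ∃ b, IsLUB (Set.range z) b
  exists_rapid : ∀ a : S, ∃ z : ℕ → S, RapidlyIncreasing z ∧ IsLUB (Set.range z) a
  isLUB_add : ∀ y z : ℕ → S, Monotone y → Monotone z → ∀ a b, IsLUB (Set.range y) a →
    IsLUB (Set.range z) b → IsLUB (Set.range fun n => y n + z n) (a + b)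
  add_compactlyContained : ∀ a a' b b' : S, a' ≪ a → b' ≪ b → a' + b' ≪ a + b

/-- `S` is countably based: some countable `B ⊆ S` is such that each element of `S` is the supremum
of a rapidly increasing sequence of elements of `B`. -/
def CountablyBased (S : Type*) [Preorder S] : Prop :=
  ∃ B : Set S, B.Countable ∧ ∀ a : S, ∃ z : ℕ → S,
    (∀ n, z n ∈ B) ∧ RapidlyIncreasing z ∧ IsLUB (Set.range z) a

/-- Morphisms of `Cu`: additive maps preserving zero, order, suprema of increasing sequences and
compact containment. -/
structure CuHom (S : Type*) (T : Type*) [AddCommMonoid S] [PartialOrder S] [AddCommMonoid T]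
    [PartialOrder T] extends S →+ T where
  monotone' : Monotone toFun
  map_isLUB' : ∀ z : ℕ → S, Monotone z → ∀ b, IsLUB (Set.range z) b →
    IsLUB (Set.range fun n => toFun (z n)) (toFun b)
  map_compactlyContained' : ∀ a b : S, a ≪ b → toFun a ≪ toFun b

instance {S T : Type*} [AddCommMonoid S] [PartialOrder S] [AddCommMonoid T]
    [PartialOrder T] : FunLike (CuHom S T) S T where
  coe f := f.toFun
  coe_injective f g h := by
    obtain ⟨f, _, _, _⟩ := f
    obtain ⟨g, _, _, _⟩ := g
    have : f = g := DFunLike.coe_injective h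
    subst this
    rfl

instance {S T : Type*} [AddCommMonoid S] [PartialOrder S] [AddCommMonoid T]
    [PartialOrder T] : AddMonoidHomClass (CuHom S T) S T where
  map_add f := f.map_add'
  map_zero f := f.map_zero'

/-- The morphisms `c i : G i → T` exhibit `T` as the inductive limit in `Cu` of the system `(G, f)`
(universal property, tested on objects of `Cu` in the universe `w`). -/
def IsCuLimit {ι : Type*} [Preorder ι] {G : ι → Type*} [∀ i, AddCommMonoid (G i)]
    [∀ i, PartialOrder (G i)] (f : ∀ i j : ι, i ≤ j → CuHom (G i) (G j))
    {T : Type*} [AddCommMonoid T] [PartialOrder T] (c : ∀ i, CuHom (G i) T) : Prop :=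
  (∀ i j (h : i ≤ j) (s : G i), c j (f i j h s) = c i s) ∧
    ∀ (R : Type w) [AddCommMonoid R] [PartialOrder R] [IsCu R] (g : ∀ i, CuHom (G i) R),
      (∀ i j (h : i ≤ j) (s : G i), g j (f i j h s) = g i s) →
        ∃! k : CuHom T R, ∀ i (s : G i), k (c i s) = g i s

section basic

variable {S : Type*} {T : Type*} [PartialOrder S] [PartialOrder T]

theorem CuHom.monotone [AddCommMonoid S] [AddCommMonoid T] (f : CuHom S T) : Monotone f := f.monotone'

theorem CuHom.map_isLUB [AddCommMonoid S] [AddCommMonoid T] (f : CuHom S T) {z : ℕ → S} (hz : Monotone z) {b : S}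
    (hb : IsLUB (Set.range z) b) : IsLUB (Set.range fun n => f (z n)) (f b) :=
  f.map_isLUB' z hz b hb

theorem CuHom.map_cc [AddCommMonoid S] [AddCommMonoid T] (f : CuHom S T) {a b : S} (h : a ≪ b) : f a ≪ f b :=
  f.map_compactlyContained' a b h

theorem CompactlyContained.le {a b : S} (h : a ≪ b) : a ≤ b := by
  obtain ⟨_, h⟩ := h (fun _ => b) monotone_const b (by simp) le_rfl
  exact h

theorem CompactlyContained.trans_le {a b c : S} (h : a ≪ b) (h' : b ≤ c) : a ≪ c :=
  fun z hz d hd hcd => h z hz d hd (h'.trans hcd)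

theorem CompactlyContained.le_trans {a b c : S} (h : a ≤ b) (h' : b ≪ c) : a ≪ c :=
  fun z hz d hd hcd => (h' z hz d hd hcd).imp fun _ hm => h.trans hm

theorem RapidlyIncreasing.monotone {z : ℕ → S} (h : RapidlyIncreasing z) : Monotone z :=
  monotone_nat_of_le_succ fun n => (h n).le

theorem RapidlyIncreasing.cc {z : ℕ → S} (h : RapidlyIncreasing z) {a : S}
    (ha : IsLUB (Set.range z) a) (n : ℕ) : z n ≪ a :=
  (h n).trans_le (ha.1 ⟨_, rfl⟩)

theorem exists_cc_of_cc_isLUB [AddCommMonoid S] [IsCu S] {z : ℕ → S} (hz : Monotone z) {a b : S}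
    (hb : IsLUB (Set.range z) b) (h : a ≪ b) : ∃ n, a ≪ z n := by
  obtain ⟨y, hy, hyb⟩ := IsCu.exists_rapid b
  obtain ⟨m, hm⟩ := h y hy.monotone b hyb le_rfl
  obtain ⟨n, hn⟩ := hy.cc hyb (m + 1) z hz b hb le_rfl
  exact ⟨n, ((hy m).trans_le hn).le_trans hm⟩

end basic

/-! ## Inductive limits in `Cu`

The inductive limit in `Cu` of a directed system is not the algebraic limit. It is obtained from the
algebraic limit `W`, equipped with the relation `≺` induced by `≪`, by adjoining suprema of
`≺`-increasing sequences: its elements are the sets `{a | a ≺ uₙ for some n}` (ordered by inclusion)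
where `u₀ ≺ u₁ ≺ ⋯` in `W`. -/

/-- A commutative monoid with a relation `≺` that has the formal properties of `≪`. -/
class PrecMonoid (W : Type*) [AddCommMonoid W] where
  prec : W → W → Prop
  trans : ∀ a b c, prec a b → prec b c → prec a c
  zero_prec : ∀ a, prec 0 a
  add_prec : ∀ a b c d, prec a b → prec c d → prec (a + c) (b + d)
  exists_rapid : ∀ a, ∃ z : ℕ → W, (∀ n, prec (z n) (z (n + 1))) ∧
    ∀ b, prec b a ↔ ∃ n, prec b (z n)
  prec_add : ∀ a b c, prec c (a + b) → ∃ a' b', prec a' a ∧ prec b' b ∧ prec c (a' + b')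

infix:50 " ≺ " => PrecMonoid.prec

/-- The completion of `(W, ≺)`. -/
def Completion (W : Type*) [AddCommMonoid W] [PrecMonoid W] : Type _ :=
  {D : Set W // ∃ z : ℕ → W, (∀ n, z n ≺ z (n + 1)) ∧ D = {a | ∃ n, a ≺ z n}}

namespace Completion

variable {W : Type*} [AddCommMonoid W] [PrecMonoid W]

instance : PartialOrder (Completion W) := Subtype.partialOrder _

theorem prec_of_lt {z : ℕ → W} (hz : ∀ n, z n ≺ z (n + 1)) {m n : ℕ} (h : m < n) :
    z m ≺ z n := by
  induction n, h using Nat.le_induction with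
  | base => exact hz m
  | succ n _ ih => exact PrecMonoid.trans _ _ _ ih (hz n)

theorem down (D : Completion W) {a b : W} (h : a ≺ b) (hb : b ∈ D.1) : a ∈ D.1 := by
  obtain ⟨D, z, hz, rfl⟩ := D
  obtain ⟨n, hn⟩ := hb
  exact ⟨n, PrecMonoid.trans _ _ _ h hn⟩

theorem directed (D : Completion W) {a b : W} (ha : a ∈ D.1) (hb : b ∈ D.1) :
    ∃ c ∈ D.1, a ≺ c ∧ b ≺ c := by
  obtain ⟨D, z, hz, rfl⟩ := D
  obtain ⟨n, hn⟩ := ha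
  obtain ⟨m, hm⟩ := hb
  exact ⟨z (max n m + 1), ⟨_, hz _⟩,
    PrecMonoid.trans _ _ _ hn (prec_of_lt hz (by omega)),
    PrecMonoid.trans _ _ _ hm (prec_of_lt hz (by omega))⟩

theorem round (D : Completion W) {a : W} (ha : a ∈ D.1) : ∃ c ∈ D.1, a ≺ c :=
  let ⟨c, hc, h, _⟩ := D.directed ha ha
  ⟨c, hc, h⟩

theorem zero_mem (D : Completion W) : (0 : W) ∈ D.1 := by
  obtain ⟨D, z, hz, rfl⟩ := D
  exact ⟨0, PrecMonoid.zero_prec _⟩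

/-- A directed down-set with a countable cofinal subset belongs to the completion. -/
theorem exists_generator (D : Set W) (h₁ : ∀ a b, a ≺ b → b ∈ D → a ∈ D)
    (h₂ : ∀ a ∈ D, ∀ b ∈ D, ∃ c ∈ D, a ≺ c ∧ b ≺ c)
    (h₃ : ∃ y : ℕ → W, (∀ n, y n ∈ D) ∧ ∀ a ∈ D, ∃ n, a ≺ y n) :
    ∃ z : ℕ → W, (∀ n, z n ≺ z (n + 1)) ∧ D = {a | ∃ n, a ≺ z n} := by
  obtain ⟨y, hy, hyD⟩ := h₃
  choose! c hcD hc using h₂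
  let z : ℕ → D := fun n =>
    Nat.rec ⟨y 0, hy 0⟩ (fun n p => ⟨c p.1 (y (n + 1)), hcD _ p.2 _ (hy _)⟩) n
  refine ⟨fun n => (z n).1, fun n => (hc _ (z n).2 _ (hy (n + 1))).1, ?_⟩
  ext a
  constructor
  · intro ha
    obtain ⟨n, hn⟩ := hyD a ha
    refine ⟨n, ?_⟩
    cases n with
    | zero => exact hn
    | succ n => exact PrecMonoid.trans _ _ _ hn (hc _ (z n).2 _ (hy (n + 1))).2
  · rintro ⟨n, hn⟩
    exact h₁ _ _ hn (z n).2

/-- The image of `a ∈ W` in the completion. -/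
def of (a : W) : Completion W :=
  ⟨{b | b ≺ a}, by
    obtain ⟨z, hz, h⟩ := PrecMonoid.exists_rapid a
    exact ⟨z, hz, Set.ext h⟩⟩

theorem mem_add_iff {y z : ℕ → W} (hy : ∀ n, y n ≺ y (n + 1)) (hz : ∀ n, z n ≺ z (n + 1)) (a : W) :
    (∃ b ∈ {b | ∃ n, b ≺ y n}, ∃ c ∈ {c | ∃ n, c ≺ z n}, a ≺ b + c) ↔ ∃ n, a ≺ y n + z n := by
  constructor
  · rintro ⟨b, ⟨n, hn⟩, c, ⟨m, hm⟩, h⟩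
    refine ⟨max n m + 1, PrecMonoid.trans _ _ _ h (PrecMonoid.add_prec _ _ _ _ ?_ ?_)⟩
    · exact PrecMonoid.trans _ _ _ hn (prec_of_lt hy (by omega))
    · exact PrecMonoid.trans _ _ _ hm (prec_of_lt hz (by omega))
  · rintro ⟨n, h⟩
    exact ⟨y n, ⟨_, hy n⟩, z n, ⟨_, hz n⟩, h⟩

instance : Add (Completion W) where
  add D E := ⟨{a | ∃ b ∈ D.1, ∃ c ∈ E.1, a ≺ b + c}, by
    obtain ⟨D, y, hy, rfl⟩ := D
    obtain ⟨E, z, hz, rfl⟩ := E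
    exact ⟨fun n => y n + z n, fun n => PrecMonoid.add_prec _ _ _ _ (hy n) (hz n),
      Set.ext (mem_add_iff hy hz)⟩⟩

instance : Zero (Completion W) where
  zero := of 0

theorem mem_add {D E : Completion W} {a : W} :
    a ∈ (D + E).1 ↔ ∃ b ∈ D.1, ∃ c ∈ E.1, a ≺ b + c := Iff.rfl

theorem mem_zero {a : W} : a ∈ (0 : Completion W).1 ↔ a ≺ 0 := Iff.rfl

theorem mem_of {a b : W} : a ∈ (of b).1 ↔ a ≺ b := Iff.rfl

theorem le_def {D E : Completion W} : D ≤ E ↔ D.1 ⊆ E.1 := Iff.rfl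

protected theorem add_comm (D E : Completion W) : D + E = E + D := by
  apply Subtype.ext
  ext a
  rw [mem_add, mem_add]
  constructor <;>
  · rintro ⟨b, hb, c, hc, h⟩
    exact ⟨c, hc, b, hb, add_comm b c ▸ h⟩

protected theorem add_zero (D : Completion W) : D + 0 = D := by
  apply Subtype.ext
  ext a
  rw [mem_add]
  constructor
  · rintro ⟨b, hb, c, hc, h⟩
    obtain ⟨d, hd, hbd⟩ := D.round hb
    have := PrecMonoid.add_prec _ _ _ _ hbd hc
    rw [add_zero] at this
    exact D.down (PrecMonoid.trans _ _ _ h this) hd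
  · intro ha
    obtain ⟨b, hb, hab⟩ := D.round ha
    exact ⟨b, hb, 0, PrecMonoid.zero_prec _, by rwa [add_zero]⟩

theorem mem_add_add {D E F : Completion W} {a : W} :
    a ∈ (D + E + F).1 ↔ ∃ b ∈ D.1, ∃ c ∈ E.1, ∃ d ∈ F.1, a ≺ b + c + d := by
  constructor
  · rintro ⟨e, ⟨b, hb, c, hc, he⟩, d, hd, h⟩
    obtain ⟨d', hd', hdd⟩ := F.round hd
    exact ⟨b, hb, c, hc, d', hd', PrecMonoid.trans _ _ _ h (PrecMonoid.add_prec _ _ _ _ he hdd)⟩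
  · rintro ⟨b, hb, c, hc, d, hd, h⟩
    obtain ⟨b', hb', hbb⟩ := D.round hb
    obtain ⟨c', hc', hcc⟩ := E.round hc
    exact ⟨b + c, ⟨b', hb', c', hc', PrecMonoid.add_prec _ _ _ _ hbb hcc⟩, d, hd, h⟩

instance : AddCommMonoid (Completion W) where
  add_assoc D E F := by
    rw [Completion.add_comm D (E + F)]
    apply Subtype.ext
    ext a
    rw [mem_add_add, mem_add_add]
    constructor
    · rintro ⟨b, hb, c, hc, d, hd, h⟩
      exact ⟨c, hc, d, hd, b, hb, by rwa [add_comm (c + d), ← add_assoc]⟩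
    · rintro ⟨c, hc, d, hd, b, hb, h⟩
      exact ⟨b, hb, c, hc, d, hd, by rwa [add_assoc, add_comm b]⟩
  zero_add D := by rw [Completion.add_comm, Completion.add_zero]
  add_zero := Completion.add_zero
  add_comm := Completion.add_comm
  nsmul := nsmulRec

theorem exists_union (z : ℕ → Completion W) (hz : Monotone z) :
    ∃ E : Completion W, E.1 = ⋃ n, (z n).1 := by
  refine ⟨⟨⋃ n, (z n).1, exists_generator _ ?_ ?_ ?_⟩, rfl⟩
  · intro a b h hb
    obtain ⟨n, hn⟩ := Set.mem_iUnion.1 hb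
    exact Set.mem_iUnion.2 ⟨n, (z n).down h hn⟩
  · intro a ha b hb
    obtain ⟨n, hn⟩ := Set.mem_iUnion.1 ha
    obtain ⟨m, hm⟩ := Set.mem_iUnion.1 hb
    obtain ⟨c, hc, h⟩ := (z (max n m)).directed (hz (le_max_left n m) hn) (hz (le_max_right n m) hm)
    exact ⟨c, Set.mem_iUnion.2 ⟨_, hc⟩, h⟩
  · choose y hy hyz using fun n => (z n).2
    refine ⟨fun k => y k.unpair.1 k.unpair.2, fun k => Set.mem_iUnion.2 ⟨k.unpair.1, ?_⟩, ?_⟩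
    · rw [hyz]
      exact ⟨_, hy _ _⟩
    · intro a ha
      obtain ⟨n, hn⟩ := Set.mem_iUnion.1 ha
      rw [hyz] at hn
      obtain ⟨m, hm⟩ := hn
      exact ⟨Nat.pair n m, by simpa using hm⟩

theorem isLUB_iff {z : ℕ → Completion W} (hz : Monotone z) {E : Completion W} :
    IsLUB (Set.range z) E ↔ E.1 = ⋃ n, (z n).1 := by
  have key : ∀ F : Completion W, F.1 = ⋃ n, (z n).1 → IsLUB (Set.range z) F := by
    intro F hF
    constructor
    · rintro _ ⟨n, rfl⟩
      rw [le_def, hF]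
      exact Set.subset_iUnion (fun n => (z n).1) n
    · intro G hG
      rw [le_def, hF]
      exact Set.iUnion_subset fun n => hG ⟨n, rfl⟩
  refine ⟨fun h => ?_, key E⟩
  obtain ⟨F, hF⟩ := exists_union z hz
  rw [h.unique (key F hF), hF]

theorem of_mono {a b : W} (h : a ≺ b) : of a ≤ of b := fun _ hc => PrecMonoid.trans _ _ _ hc h

theorem exists_isLUB_of (D : Completion W) : ∃ z : ℕ → W, (∀ n, z n ≺ z (n + 1)) ∧
    (∀ a, a ∈ D.1 ↔ ∃ n, a ≺ z n) ∧ Monotone (fun n => of (z n)) ∧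
      IsLUB (Set.range fun n => of (z n)) D := by
  obtain ⟨D, z, hz, rfl⟩ := D
  have hm : Monotone (fun n => of (z n)) := monotone_nat_of_le_succ fun n => of_mono (hz n)
  refine ⟨z, hz, fun a => Iff.rfl, hm, (isLUB_iff hm).2 ?_⟩
  ext a
  simp [mem_of]

theorem cc_iff {D E : Completion W} : D ≪ E ↔ ∃ b ∈ E.1, D ≤ of b := by
  constructor
  · intro h
    obtain ⟨z, hz, hE, hm, hl⟩ := exists_isLUB_of E
    obtain ⟨n, hn⟩ := h _ hm _ hl le_rfl
    exact ⟨z n, (hE _).2 ⟨_, hz n⟩, hn⟩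
  · rintro ⟨b, hb, h⟩ z hz F hF hEF
    rw [isLUB_iff hz] at hF
    have := hEF hb
    rw [hF] at this
    obtain ⟨n, hn⟩ := Set.mem_iUnion.1 this
    exact ⟨n, fun a ha => (z n).down (h ha) hn⟩

theorem of_cc {a b : W} (h : a ≺ b) : of a ≪ of b := cc_iff.2 ⟨a, h, le_rfl⟩

instance : IsCu (Completion W) where
  zero_le D := fun a ha => D.down ha D.zero_mem
  add_le_add_right D E F h := by
    rintro a ⟨b, hb, c, hc, h'⟩
    exact ⟨b, h hb, c, hc, h'⟩
  exists_isLUB z hz := (exists_union z hz).imp fun _ h => (isLUB_iff hz).2 h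
  exists_rapid D := by
    obtain ⟨z, hz, _, _, hl⟩ := exists_isLUB_of D
    exact ⟨_, fun n => of_cc (hz n), hl⟩
  isLUB_add y z hy hz D E hD hE := by
    have hm : Monotone fun n => y n + z n := by
      rintro m n h a ⟨b, hb, c, hc, h'⟩
      exact ⟨b, hy h hb, c, hz h hc, h'⟩
    rw [isLUB_iff hy] at hD
    rw [isLUB_iff hz] at hE
    rw [isLUB_iff hm]
    ext a
    rw [mem_add, hD, hE]
    simp only [Set.mem_iUnion]
    constructor
    · rintro ⟨b, ⟨n, hb⟩, c, ⟨m, hc⟩, h⟩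
      exact ⟨max n m, b, hy (le_max_left n m) hb, c, hz (le_max_right n m) hc, h⟩
    · rintro ⟨n, b, hb, c, hc, h⟩
      exact ⟨b, ⟨n, hb⟩, c, ⟨n, hc⟩, h⟩
  add_compactlyContained D D' E E' hD hE := by
    obtain ⟨b, hb, hDb⟩ := cc_iff.1 hD
    obtain ⟨c, hc, hEc⟩ := cc_iff.1 hE
    obtain ⟨b', hb', hbb⟩ := D.round hb
    obtain ⟨c', hc', hcc⟩ := E.round hc
    refine cc_iff.2 ⟨b + c, ⟨b', hb', c', hc', PrecMonoid.add_prec _ _ _ _ hbb hcc⟩, ?_⟩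
    rintro a ⟨d, hd, e, he, h⟩
    exact PrecMonoid.trans _ _ _ h (PrecMonoid.add_prec _ _ _ _ (hDb hd) (hEc he))

theorem of_zero : of (0 : W) = 0 := rfl

theorem of_add (a b : W) : of (a + b) = of a + of b := by
  apply Subtype.ext
  ext c
  rw [mem_add, mem_of]
  constructor
  · intro h
    obtain ⟨a', b', ha, hb, h'⟩ := PrecMonoid.prec_add _ _ _ h
    exact ⟨a', ha, b', hb, h'⟩
  · rintro ⟨a', ha, b', hb, h⟩
    exact PrecMonoid.trans _ _ _ h (PrecMonoid.add_prec _ _ _ _ ha hb)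

end Completion

section limit

variable {ι : Type*} [Preorder ι] [IsDirectedOrder ι] {G : ι → Type*}
  [∀ i, AddCommMonoid (G i)] [∀ i, PartialOrder (G i)]
  {f : ∀ i j : ι, i ≤ j → CuHom (G i) (G j)} [DirectedSystem G (f · · ·)]

/-- The relation induced by `≪` on the algebraic inductive limit. -/
def germPrec (a b : DirectLimit G f) : Prop :=
  ∃ (i : ι) (s t : G i), a = ⟦⟨i, s⟩⟧ ∧ b = ⟦⟨i, t⟩⟧ ∧ s ≪ t

theorem germPrec_mk {i : ι} {s t : G i} :
    germPrec (⟦⟨i, s⟩⟧ : DirectLimit G f) ⟦⟨i, t⟩⟧ ↔ ∃ j, ∃ h : i ≤ j, f i j h s ≪ f i j h t := by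
  constructor
  · rintro ⟨j, s', t', hs, ht, h⟩
    obtain ⟨k, hik, hjk, hk⟩ := Quotient.exact hs
    obtain ⟨l, hil, hjl, hl⟩ := Quotient.exact ht
    obtain ⟨m, hkm, hlm⟩ := exists_ge_ge k l
    refine ⟨m, hik.trans hkm, ?_⟩
    have h1 := congrArg (f k m hkm) hk
    have h2 := congrArg (f l m hlm) hl
    simp only [DirectedSystem.map_map' (f := f)] at h1 h2
    rw [h1, h2]
    exact (f _ _ _).map_cc h
  · rintro ⟨j, h, h'⟩
    exact ⟨j, _, _, (DirectLimit.mk_apply (f := f) i j s h).symm, (DirectLimit.mk_apply i j t h).symm, h'⟩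

variable [Nonempty ι] [∀ i, IsCu (G i)]

noncomputable instance : PrecMonoid (DirectLimit G f) where
  prec := germPrec
  trans a b c := by
    obtain ⟨i, s, t, r, rfl, rfl, rfl⟩ := DirectLimit.exists_eq_mk₃ f a b c
    rw [germPrec_mk, germPrec_mk, germPrec_mk]
    rintro ⟨j, hij, h⟩ ⟨k, hik, h'⟩
    obtain ⟨m, hjm, hkm⟩ := exists_ge_ge j k
    refine ⟨m, hij.trans hjm, ?_⟩
    have h1 := (f j m hjm).map_cc h
    have h2 := (f k m hkm).map_cc h'
    simp only [DirectedSystem.map_map' (f := f)] at h1 h2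
    exact h1.trans_le h2.le
  zero_prec a := by
    obtain ⟨i, s, rfl⟩ := DirectLimit.exists_eq_mk f a
    refine ⟨i, 0, s, DirectLimit.zero_def i, rfl, ?_⟩
    intro z _ _ _ _
    exact ⟨0, IsCu.zero_le _⟩
  add_prec a b c d := by
    rintro ⟨i, s, t, rfl, rfl, h⟩ ⟨j, s', t', rfl, rfl, h'⟩
    obtain ⟨k, hik, hjk⟩ := exists_ge_ge i j
    refine ⟨k, f i k hik s + f j k hjk s', f i k hik t + f j k hjk t', ?_, ?_,
      IsCu.add_compactlyContained _ _ _ _ ((f _ _ _).map_cc h) ((f _ _ _).map_cc h')⟩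
    · rw [← DirectLimit.add_def, DirectLimit.mk_apply, DirectLimit.mk_apply]
    · rw [← DirectLimit.add_def, DirectLimit.mk_apply, DirectLimit.mk_apply]
  exists_rapid a := by
    obtain ⟨i, s, rfl⟩ := DirectLimit.exists_eq_mk f a
    obtain ⟨z, hz, hs⟩ := IsCu.exists_rapid s
    refine ⟨fun n => ⟦⟨i, z n⟩⟧, fun n => ⟨i, _, _, rfl, rfl, hz n⟩, fun b => ?_⟩
    obtain ⟨j, hij, r, rfl⟩ : ∃ j, ∃ _ : i ≤ j, ∃ r : G j, b = ⟦⟨j, r⟩⟧ := by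
      obtain ⟨k, t, rfl⟩ := DirectLimit.exists_eq_mk f b
      obtain ⟨j, hij, hkj⟩ := exists_ge_ge i k
      exact ⟨j, hij, f k j hkj t, (DirectLimit.mk_apply k j t hkj).symm⟩
    rw [← DirectLimit.mk_apply i j s hij, germPrec_mk]
    simp only [← DirectLimit.mk_apply i j _ hij, germPrec_mk]
    constructor
    · rintro ⟨k, hjk, h⟩
      rw [DirectedSystem.map_map' (f := f)] at h
      obtain ⟨n, hn⟩ := exists_cc_of_cc_isLUB ((f i k _).monotone.comp hz.monotone)
        ((f i k _).map_isLUB hz.monotone hs) h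
      refine ⟨n, k, hjk, ?_⟩
      rwa [DirectedSystem.map_map' (f := f)]
    · rintro ⟨n, k, hjk, h⟩
      exact ⟨k, hjk, h.trans_le ((f _ _ _).monotone ((f _ _ _).monotone (hs.1 ⟨n, rfl⟩)))⟩
  prec_add a b c := by
    obtain ⟨i, s, t, r, rfl, rfl, rfl⟩ := DirectLimit.exists_eq_mk₃ f a b c
    rw [DirectLimit.add_def, germPrec_mk]
    rintro ⟨j, hij, h⟩
    obtain ⟨y, hy, hs⟩ := IsCu.exists_rapid s
    obtain ⟨z, hz, ht⟩ := IsCu.exists_rapid t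
    have hl := IsCu.isLUB_add y z hy.monotone hz.monotone s t hs ht
    have hm : Monotone fun n => y n + z n := monotone_nat_of_le_succ fun n =>
      (IsCu.add_compactlyContained _ _ _ _ (hy n) (hz n)).le
    obtain ⟨n, hn⟩ := exists_cc_of_cc_isLUB ((f i j hij).monotone.comp hm)
      ((f i j hij).map_isLUB hm hl) h
    refine ⟨⟦⟨i, y n⟩⟧, ⟦⟨i, z n⟩⟧, ⟨i, _, _, rfl, rfl, hy.cc hs n⟩,
      ⟨i, _, _, rfl, rfl, hz.cc ht n⟩, ?_⟩
    rw [DirectLimit.add_def, germPrec_mk]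
    exact ⟨j, hij, hn⟩

theorem of_germ_mono {i : ι} {s t : G i} (h : s ≤ t) :
    Completion.of (⟦⟨i, s⟩⟧ : DirectLimit G f) ≤ Completion.of (⟦⟨i, t⟩⟧ : DirectLimit G f) := by
  intro a ha
  obtain ⟨j, r, rfl⟩ := DirectLimit.exists_eq_mk f a
  obtain ⟨k, hik, hjk⟩ := exists_ge_ge i j
  rw [Completion.mem_of, ← DirectLimit.mk_apply (f := f) j k r hjk,
    ← DirectLimit.mk_apply (f := f) i k s hik] at ha
  rw [Completion.mem_of, ← DirectLimit.mk_apply (f := f) j k r hjk,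
    ← DirectLimit.mk_apply (f := f) i k t hik]
  obtain ⟨m, hkm, hm⟩ := germPrec_mk.1 ha
  exact germPrec_mk.2 ⟨m, hkm, hm.trans_le ((f _ _ _).monotone ((f _ _ _).monotone h))⟩

variable (f) in
/-- The inductive limit in `Cu` of a directed system. -/
abbrev CuLimit : Type _ := Completion (DirectLimit G f)

variable (f) in
/-- The canonical morphism from a term of the system to the limit. -/
noncomputable def CuLimit.of (i : ι) : CuHom (G i) (CuLimit f) where
  toFun s := Completion.of (⟦⟨i, s⟩⟧ : DirectLimit G f)
  map_zero' := by
    rw [← DirectLimit.zero_def i]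
    exact Completion.of_zero
  map_add' s t := by
    rw [← DirectLimit.add_def]
    exact Completion.of_add _ _
  monotone' _ _ h := of_germ_mono h
  map_isLUB' z hz b hb := by
    have hm : Monotone fun n => Completion.of (⟦⟨i, z n⟩⟧ : DirectLimit G f) :=
      fun m n h => of_germ_mono (hz h)
    refine (Completion.isLUB_iff hm).2 (Set.Subset.antisymm ?_ ?_)
    · intro a ha
      obtain ⟨j, r, rfl⟩ := DirectLimit.exists_eq_mk f a
      obtain ⟨k, hik, hjk⟩ := exists_ge_ge i j
      have e := DirectLimit.mk_apply (f := f) j k r hjk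
      have e1 := DirectLimit.mk_apply (f := f) i k b hik
      rw [Completion.mem_of, ← e, ← e1] at ha
      obtain ⟨m, hkm, hm⟩ := germPrec_mk.1 ha
      rw [DirectedSystem.map_map' (f := f) hik hkm b] at hm
      obtain ⟨n, hn⟩ := exists_cc_of_cc_isLUB ((f i m _).monotone.comp hz)
        ((f i m _).map_isLUB hz hb) hm
      refine Set.mem_iUnion.2 ⟨n, ?_⟩
      have e2 := DirectLimit.mk_apply (f := f) i k (z n) hik
      rw [Completion.mem_of, ← e, ← e2]
      refine germPrec_mk.2 ⟨m, hkm, ?_⟩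
      rw [DirectedSystem.map_map' (f := f) hik hkm (z n)]
      exact hn
    · exact Set.iUnion_subset fun n => of_germ_mono (hb.1 ⟨n, rfl⟩)
  map_compactlyContained' s t h := Completion.of_cc ⟨i, s, t, rfl, rfl, h⟩

/-- `CuLimit f` has the universal property of the inductive limit in the category `Cu`. -/
theorem CuLimit.isCuLimit : IsCuLimit.{w} f (CuLimit.of f) := by
  refine ⟨fun i j h s => congrArg Completion.of (DirectLimit.mk_apply (f := f) i j s h), ?_⟩
  intro R _ _ _ g hg
  let extend : DirectLimit G f → R := DirectLimit.lift f (fun i s => g i s) fun i j h s => (hg i j h s).symm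
  have extend_mk : ∀ (i : ι) (s : G i), extend (⟦⟨i, s⟩⟧ : DirectLimit G f) = g i s := fun i s => rfl
  have extend_cc : ∀ a b : DirectLimit G f, a ≺ b → extend a ≪ extend b := by
    rintro _ _ ⟨i, s, t, rfl, rfl, h⟩
    exact (g i).map_cc h
  have extend_add : ∀ a b, extend (a + b) = extend a + extend b := by
    intro a b
    obtain ⟨i, s, t, rfl, rfl⟩ := DirectLimit.exists_eq_mk₂ f a b
    rw [DirectLimit.add_def, extend_mk, extend_mk, extend_mk, map_add]
  have extend_zero : extend 0 = 0 := by
    obtain ⟨i⟩ := ‹Nonempty ι›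
    rw [DirectLimit.zero_def i, extend_mk, map_zero]
  have lub_iff : ∀ (D : CuLimit f) (z : ℕ → DirectLimit G f), (∀ n, z n ≺ z (n + 1)) →
      (∀ a, a ∈ D.1 ↔ ∃ n, a ≺ z n) → ∀ t,
      IsLUB (Set.range fun n => extend (z n)) t ↔ IsLUB (extend '' D.1) t := by
    intro D z hz hD t
    have : upperBounds (Set.range fun n => extend (z n)) = upperBounds (extend '' D.1) := by
      ext r
      constructor
      · rintro h _ ⟨a, ha, rfl⟩
        obtain ⟨n, hn⟩ := (hD a).1 ha
        exact (extend_cc _ _ hn).le.trans (h ⟨n, rfl⟩)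
      · rintro h _ ⟨n, rfl⟩
        exact h ⟨z n, (hD _).2 ⟨_, hz n⟩, rfl⟩
    rw [IsLUB, IsLUB, this]
  have extend_mono : ∀ z : ℕ → DirectLimit G f, (∀ n, z n ≺ z (n + 1)) → Monotone fun n => extend (z n) :=
    fun z hz => monotone_nat_of_le_succ fun n => (extend_cc _ _ (hz n)).le
  have ex : ∀ D : CuLimit f, ∃ t, IsLUB (extend '' D.1) t := by
    intro D
    obtain ⟨z, hz, hD, _, _⟩ := Completion.exists_isLUB_of D
    obtain ⟨t, ht⟩ := IsCu.exists_isLUB _ (extend_mono z hz)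
    exact ⟨t, (lub_iff D z hz hD t).1 ht⟩
  choose k hk using ex
  have k_mono : Monotone k := fun D E h => (hk D).mono (hk E) (Set.image_mono h)
  have k_of : ∀ i s, k (CuLimit.of f i s) = g i s := by
    intro i s
    obtain ⟨z, hz, hs⟩ := IsCu.exists_rapid s
    refine (hk _).unique ?_
    have h1 := (g i).map_isLUB hz.monotone hs
    have h2 := (Completion.isLUB_iff ((CuLimit.of f i).monotone.comp hz.monotone)).1
      ((CuLimit.of f i).map_isLUB hz.monotone hs)
    refine (lub_iff _ (fun n => ⟦⟨i, z n⟩⟧) (fun n => ⟨i, _, _, rfl, rfl, hz n⟩) ?_ _).1 h1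
    intro a
    rw [h2]
    exact Set.mem_iUnion
  let K : CuHom (CuLimit f) R :=
    { toFun := k
      map_zero' := by
        refine (hk 0).unique ⟨?_, ?_⟩
        · rintro _ ⟨a, ha, rfl⟩
          have := (extend_cc a 0 ha).le
          rwa [extend_zero] at this
        · intro t ht
          exact IsCu.zero_le t
      map_add' := by
        intro D E
        obtain ⟨y, hy, hD, _, _⟩ := Completion.exists_isLUB_of D
        obtain ⟨z, hz, hE, _, _⟩ := Completion.exists_isLUB_of E
        have h := IsCu.isLUB_add _ _ (extend_mono y hy) (extend_mono z hz) _ _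
          ((lub_iff D y hy hD _).2 (hk D)) ((lub_iff E z hz hE _).2 (hk E))
        refine (hk (D + E)).unique ?_
        refine (lub_iff (D + E) (fun n => y n + z n)
          (fun n => PrecMonoid.add_prec _ _ _ _ (hy n) (hz n)) ?_ _).1 ?_
        · intro a
          rw [← Completion.mem_add_iff hy hz]
          simp only [Set.mem_ofPred_eq, ← hD, ← hE]
          exact Completion.mem_add
        · simpa only [extend_add] using h
      monotone' := k_mono
      map_isLUB' := by
        intro z hz D hD
        constructor
        · rintro _ ⟨n, rfl⟩
          exact k_mono (hD.1 ⟨n, rfl⟩)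
        · intro t ht
          refine (hk D).2 ?_
          rintro _ ⟨a, ha, rfl⟩
          rw [Completion.isLUB_iff hz] at hD
          rw [hD] at ha
          obtain ⟨n, hn⟩ := Set.mem_iUnion.1 ha
          exact ((hk (z n)).1 ⟨a, hn, rfl⟩).trans (ht ⟨n, rfl⟩)
      map_compactlyContained' := by
        intro D E h
        obtain ⟨b, hb, hD⟩ := Completion.cc_iff.1 h
        obtain ⟨c, hc, hbc⟩ := Completion.round E hb
        have h1 : k D ≤ extend b := by
          refine (hk D).2 ?_
          rintro _ ⟨a, ha, rfl⟩
          exact (extend_cc _ _ (hD ha)).le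
        exact ((extend_cc _ _ hbc).trans_le ((hk E).1 ⟨c, hc, rfl⟩)).le_trans h1 }
  refine ⟨K, k_of, ?_⟩
  intro K' hK'
  apply DFunLike.ext
  intro D
  obtain ⟨z, hz, hD, hm, hl⟩ := Completion.exists_isLUB_of D
  have e : ∀ a : DirectLimit G f, K' (Completion.of a : CuLimit f) = K (Completion.of a : CuLimit f) := by
    intro a
    obtain ⟨i, s, rfl⟩ := DirectLimit.exists_eq_mk f a
    exact (hK' i s).trans (k_of i s).symm
  have h1 := K'.map_isLUB hm hl
  have h2 := K.map_isLUB hm hl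
  simp only [e] at h1
  exact h1.unique h2

end limit

/-! ## Presheaves on the closed sets with non-empty interior -/

/-- The closed subsets of `X` with non-empty interior. -/
@[ext]
structure ClosedRegion (X : Type*) [TopologicalSpace X] where
  carrier : Set X
  isClosed : IsClosed carrier
  nonempty_interior : (interior carrier).Nonempty

/-- Closed sets with non-empty interior are ordered by inclusion. -/
instance {X : Type*} [TopologicalSpace X] : PartialOrder (ClosedRegion X) where
  le V W := V.carrier ⊆ W.carrier
  le_refl _ := Set.Subset.rfl
  le_trans _ _ _ h h' := Set.Subset.trans h h'
  le_antisymm _ _ h h' := ClosedRegion.ext (Set.Subset.antisymm h h')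

/-- The whole space. -/
def ClosedRegion.whole (X : Type*) [TopologicalSpace X] [Nonempty X] : ClosedRegion X :=
  ⟨Set.univ, isClosed_univ, by simp⟩

/-- The union of two closed sets with non-empty interior. -/
def ClosedRegion.union {X : Type*} [TopologicalSpace X] (V W : ClosedRegion X) : ClosedRegion X :=
  ⟨V.carrier ∪ W.carrier, V.isClosed.union W.isClosed,
    V.nonempty_interior.mono (interior_mono Set.subset_union_left)⟩

/-- A presheaf on `X` with values in the category `Cu`. -/
structure CuPresheaf (X : Type u) [TopologicalSpace X] where
  obj : ClosedRegion X → Type v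
  [addCommMonoid : ∀ V, AddCommMonoid (obj V)]
  [partialOrder : ∀ V, PartialOrder (obj V)]
  [isCu : ∀ V, IsCu (obj V)]
  res : ∀ {V W : ClosedRegion X}, W ≤ V → CuHom (obj V) (obj W)
  res_self : ∀ (V : ClosedRegion X) (s : obj V), res (le_refl V) s = s
  res_res : ∀ {U V W : ClosedRegion X} (hVU : V ≤ U) (hWV : W ≤ V) (s : obj U),
    res hWV (res hVU s) = res (hWV.trans hVU) s

attribute [instance] CuPresheaf.addCommMonoid CuPresheaf.partialOrder CuPresheaf.isCu

/-- The closed subsets of `X` whose interior contains `x`. -/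
structure ClosedNhd {X : Type*} [TopologicalSpace X] (x : X) where
  carrier : Set X
  isClosed : IsClosed carrier
  mem_interior : x ∈ interior carrier

section nhd

variable {X : Type*} [TopologicalSpace X] {x : X}

/-- Closed neighbourhoods are ordered by reverse inclusion. -/
instance : Preorder (ClosedNhd x) where
  le V W := W.carrier ⊆ V.carrier
  le_refl _ := Set.Subset.rfl
  le_trans _ _ _ h h' := Set.Subset.trans h' h

instance : IsDirectedOrder (ClosedNhd x) where
  directed V W := ⟨⟨V.carrier ∩ W.carrier, V.isClosed.inter W.isClosed, by
    rw [interior_inter]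
    exact ⟨V.mem_interior, W.mem_interior⟩⟩, Set.inter_subset_left, Set.inter_subset_right⟩

/-- The whole space as a neighbourhood of `x`. -/
def ClosedNhd.whole (x : X) : ClosedNhd x := ⟨Set.univ, isClosed_univ, by simp⟩

instance : Nonempty (ClosedNhd x) := ⟨ClosedNhd.whole x⟩

/-- A closed neighbourhood, as a closed set with non-empty interior. -/
def ClosedNhd.toRegion (V : ClosedNhd x) : ClosedRegion X := ⟨V.carrier, V.isClosed, x, V.mem_interior⟩

end nhd

namespace CuPresheaf

variable {X : Type u} [TopologicalSpace X] (S : CuPresheaf.{u, v} X)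

/-- The presheaf is surjective: all restriction maps are surjective. -/
def IsSurjective : Prop :=
  ∀ {V W : ClosedRegion X} (h : W ≤ V), Function.Surjective (S.res h)

/-- The presheaf is a sheaf: if `V`, `W` and `V ∩ W` are closed sets with non-empty interior, then
restriction maps `S (V ∪ W)` bijectively onto the pairs in `S V × S W` that agree on `V ∩ W`. -/
def IsSheaf : Prop :=
  ∀ (V W I : ClosedRegion X) (hI : I.carrier = V.carrier ∩ W.carrier) (p : S.obj V) (q : S.obj W),
    S.res (V := V) (W := I) (hI.trans_subset Set.inter_subset_left) p =
      S.res (V := W) (W := I) (hI.trans_subset Set.inter_subset_right) q →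
    ∃! s : S.obj (V.union W),
      S.res (V := V.union W) (W := V) Set.subset_union_left s = p ∧
        S.res (V := V.union W) (W := W) Set.subset_union_right s = q

/-- The presheaf is continuous: if `(Vₙ)` is a decreasing sequence of closed sets with non-empty
interior whose intersection `W` has non-empty interior, then `S W` is the inductive limit in `Cu`
of the `S Vₙ`. -/
def IsContinuous : Prop :=
  ∀ (V : ℕ → ClosedRegion X) (hV : Antitone V) (W : ClosedRegion X)
      (hW : W.carrier = ⋂ n, (V n).carrier),
    IsCuLimit.{v} (G := fun n => S.obj (V n)) (fun _ _ h => S.res (hV h))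
      (T := S.obj W) fun n => S.res (V := V n) (W := W)
        (hW.trans_subset (Set.iInter_subset (fun n => (V n).carrier) n))

/-- The system of the semigroups `S V` for `V` running over the closed neighbourhoods of `x`. -/
def nhdRes (x : X) (V W : ClosedNhd x) (h : V ≤ W) : CuHom (S.obj V.toRegion) (S.obj W.toRegion) :=
  S.res (V := V.toRegion) (W := W.toRegion) h

instance (x : X) : DirectedSystem (fun V : ClosedNhd x => S.obj V.toRegion) (S.nhdRes x · · ·) where
  map_self V s := S.res_self V.toRegion s
  map_map _ _ _ hij hjk s :=
    S.res_res (U := ClosedNhd.toRegion _) (V := ClosedNhd.toRegion _) (W := ClosedNhd.toRegion _)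
      hij hjk s

/-- The fiber `Sₓ`: the inductive limit in `Cu` of `S V` over the closed `V` with `x` in the
interior of `V`. -/
abbrev Fiber (x : X) : Type (max u v) := CuLimit (S.nhdRes x)

variable [Nonempty X]

/-- The semigroup of global elements. -/
abbrev global : Type v := S.obj (ClosedRegion.whole X)

/-- The natural map from the semigroup of global elements to the fiber at `x`. -/
noncomputable def toFiber (x : X) : CuHom S.global (S.Fiber x) := CuLimit.of (S.nhdRes x) (ClosedNhd.whole x)

/-- The disjoint union of the fibers. -/
def TotalSpace : Type (max u v) := Σ x : X, S.Fiber x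

/-- The set of all `a` in fibers `Sₓ`, `x ∈ U`, such that `π_x(s') ≪ a` for some `s' ≫ s`. -/
def basicOpen (U : Set X) (s : S.global) : Set S.TotalSpace :=
  {p | p.1 ∈ U ∧ ∃ s' : S.global, s ≪ s' ∧ S.toFiber p.1 s' ≪ p.2}

/-- The topology on the total space generated by the sets `basicOpen U s` with `U` open. -/
instance : TopologicalSpace S.TotalSpace :=
  TopologicalSpace.generateFrom {A | ∃ (U : Set X) (s : S.global), IsOpen U ∧ A = S.basicOpen U s}

/-- Continuity of a section of the bundle of fibers. -/
def IsContinuousSection (f : ∀ x, S.Fiber x) : Prop :=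
  Continuous (Y := S.TotalSpace) fun x => Sigma.mk x (f x)

/-- Piecewise characteristic sections: there are a finite open cover `(Uᵢ)` of `X` such that `(Uᵢ)`
and the closures have multiplicity at most two and the boundaries of the closures have dimension at
most zero, and elements `sᵢ`, `s_{i,j}` with `ŝᵢ ≤ ŝ_{i,j}` on the closure of `∂(Uᵢ ∩ Uⱼ) ∩ Uᵢ`,
such that `g` is `ŝᵢ` on `Uᵢ` outside of the other `Uⱼ`, and is `ŝ_{i,j}` on `Uᵢ ∩ Uⱼ`. -/
def IsPiecewiseCharacteristic (g : ∀ x, S.Fiber x) : Prop :=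
  ∃ (n : ℕ) (U : Fin n → Set X) (s : Fin n → S.global) (t : Sym2 (Fin n) → S.global),
    (∀ i, IsOpen (U i)) ∧ (⋃ i, U i) = Set.univ ∧
    (∀ x, {i | x ∈ U i}.ncard ≤ 2) ∧ (∀ x, {i | x ∈ closure (U i)}.ncard ≤ 2) ∧
    (∀ i, smallInductiveDimension (frontier (closure (U i))) ≤ 0) ∧
    (∀ i j, i ≠ j → ∀ x ∈ closure (frontier (U i ∩ U j) ∩ U i),
      S.toFiber x (s i) ≤ S.toFiber x (t s(i, j))) ∧
    (∀ i, ∀ x ∈ U i, (∀ j, j ≠ i → x ∉ U j) → g x = S.toFiber x (s i)) ∧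
    (∀ i j, i ≠ j → ∀ x ∈ U i ∩ U j, g x = S.toFiber x (t s(i, j)))

end CuPresheaf

end CuSheaf

/-!
Write `ŝ` for the section `x ↦ S.toFiber x s` of a global element `s`.
Suprema of sections are pointwise, and the topology of the bundle of fibers is a lower
semicontinuity condition: a section `f` is continuous if and only if `ŝ'(x) ≪ f x` and `s ≪ s'`
imply `ŝ ≪ f` near `x` (`isContinuousSection_iff`). As the restriction maps are surjective, global
elements are dense in each fiber (`IsSurjective.exists_rapid`), and closure of the continuous
sections under addition and under increasing sequences follows.

What remains is to find enough compact containments. Say that `g` is locally way below `f` if near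
each point `x` there are `s ≪ s'` with `g ≤ ŝ` and `ŝ'(x) ≪ f x`. This relation is additive
and, `X` being compact, implies `g ≪ f` (`LocallyBelow.cc`). The key step
`IsContinuousSection.exists_piecewiseCharacteristic` finds a piecewise characteristic section `g`
locally way below `f` that dominates finitely many given local lower bounds of `f`. Locally a single
`r̂` does this, so there is a finite cover `(Vᵢ)` with zero-dimensional boundaries and an `rᵢ` for
each `Vᵢ`. Removing from each `Vᵢ` the closures of its predecessors leaves disjoint open sets whose
union has a zero-dimensional complement. That complement is covered by finitely many open sets `Wₖ`
with disjoint closures, each so small that a single `qₖ` dominates on it all the `rᵢ` concerned,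
and the disjoint sets are then shrunk to sets `Oᵢ` with disjoint closures
(`exists_open_cover_two_families`). The section that is `q̂ₖ` on `Wₖ` and `r̂ᵢ` on the rest of `Oᵢ`
is the desired one: the `Oᵢ` and the `Wₖ` form a cover of multiplicity at most two, and continuity
holds because the value can only jump up on entering the open set `Wₖ`.

Finally, countable bases of `X` and of the global elements give countably many local lower bounds
which determine `f`, and interpolation between the sections already found and `f` meets them
successively (`exists_approximating_sequence`).
-/

namespace CuSheaf

open Topology Filter

/-! ### Separation by zero-dimensional closed sets -/

/-- A subset `Z` of `X` is zero-dimensional in the strong sense: any two disjoint closed subsets of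
`X` are separated by a partition of `Z` into two closed subsets of `X`. For closed `Z` in a compact
Hausdorff space this means that `Z` has small inductive dimension at most zero. -/
def IsSeparating {X : Type*} [TopologicalSpace X] (Z : Set X) : Prop :=
  ∀ K L : Set X, IsClosed K → IsClosed L → Disjoint K L → ∃ A B : Set X,
    IsClosed A ∧ IsClosed B ∧ A ∪ B = Z ∧ Disjoint A B ∧ Disjoint K B ∧ Disjoint L A

section topology

variable {X : Type*} [TopologicalSpace X]

theorem IsSeparating.isClosed {Z : Set X} (hZ : IsSeparating Z) : IsClosed Z := by
  obtain ⟨A, B, hA, hB, rfl, -⟩ := hZ ∅ ∅ isClosed_empty isClosed_empty (by simp)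
  exact hA.union hB

theorem IsSeparating.empty : IsSeparating (∅ : Set X) := fun _ _ _ _ _ =>
  ⟨∅, ∅, isClosed_empty, isClosed_empty, by simp, by simp, by simp, by simp⟩

theorem IsSeparating.mono {Y Z : Set X} (hZ : IsSeparating Z) (hY : IsClosed Y) (h : Y ⊆ Z) :
    IsSeparating Y := by
  intro K L hK hL hKL
  obtain ⟨A, B, hA, hB, hAB, hd, hKB, hLA⟩ := hZ K L hK hL hKL
  refine ⟨A ∩ Y, B ∩ Y, hA.inter hY, hB.inter hY, ?_, ?_, ?_, ?_⟩
  · rw [← Set.union_inter_distrib_right, hAB, Set.inter_eq_right.2 h]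
  · exact hd.mono Set.inter_subset_left Set.inter_subset_left
  · exact hKB.mono_right Set.inter_subset_left
  · exact hLA.mono_right Set.inter_subset_left

/-- The sum theorem for two closed zero-dimensional sets: a partition of the first set is extended
by partitioning the second one along the enlarged closed sets. -/
theorem IsSeparating.union {Y Z : Set X} (hY : IsSeparating Y) (hZ : IsSeparating Z) :
    IsSeparating (Y ∪ Z) := by
  intro K L hK hL hKL
  obtain ⟨A, B, hA, hB, rfl, hd, hKB, hLA⟩ := hY K L hK hL hKL
  obtain ⟨A', B', hA', hB', rfl, hd', hKB', hLA'⟩ := hZ (K ∪ A) (L ∪ B) (hK.union hA) (hL.union hB)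
    (by simp only [Set.disjoint_union_left, Set.disjoint_union_right]
        exact ⟨⟨hKL, hLA.symm⟩, hKB, hd⟩)
  rw [Set.disjoint_union_left] at hKB' hLA'
  refine ⟨A ∪ A', B ∪ B', hA.union hA', hB.union hB', Set.union_union_union_comm _ _ _ _, ?_, ?_, ?_⟩
  · simp only [Set.disjoint_union_left, Set.disjoint_union_right]
    exact ⟨⟨hd, hLA'.2.symm⟩, hKB'.2, hd'⟩
  · exact Set.disjoint_union_right.2 ⟨hKB, hKB'.1⟩
  · exact Set.disjoint_union_right.2 ⟨hLA, hLA'.1⟩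

theorem IsSeparating.biUnion {ι : Type*} (s : Finset ι) {Z : ι → Set X}
    (h : ∀ i ∈ s, IsSeparating (Z i)) : IsSeparating (⋃ i ∈ s, Z i) := by
  classical
  induction s using Finset.induction_on with
  | empty => simpa using IsSeparating.empty
  | insert a s _ ih =>
    rw [Finset.set_biUnion_insert]
    exact (h a (Finset.mem_insert_self _ _)).union
      (ih fun i hi => h i (Finset.mem_insert_of_mem hi))

theorem IsSeparating.smallInductiveDimension_le [T1Space X] {Z : Set X} (hZ : IsSeparating Z) :
    smallInductiveDimension Z ≤ 0 := by
  refine smallInductiveDimension_le_iff (n := 0).2 (hasSmallInductiveDimensionLT_one_iff.2 ?_)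
  refine TopologicalSpace.isTopologicalBasis_of_isOpen_of_nhds (fun U hU => hU.isOpen) ?_
  rintro x _ hx ⟨U, hU, rfl⟩
  obtain ⟨A, B, hA, hB, hAB, hd, hxB, hUA⟩ := hZ {x.1} Uᶜ isClosed_singleton hU.isClosed_compl
    (by simpa using hx)
  refine ⟨(↑) ⁻¹' A, ⟨hA.preimage continuous_subtype_val, ?_⟩, ?_, ?_⟩
  · have : ((↑) ⁻¹' A : Set Z) = ((↑) ⁻¹' B)ᶜ := by
      ext y
      have hy : y.1 ∈ A ∪ B := hAB ▸ y.2
      exact ⟨fun h h' => hd.le_bot ⟨h, h'⟩, fun h => hy.resolve_right h⟩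
    rw [this]
    exact (hB.preimage continuous_subtype_val).isOpen_compl
  · have hy : x.1 ∈ A ∪ B := hAB ▸ x.2
    exact hy.resolve_right fun h => hxB.le_bot ⟨rfl, h⟩
  · intro y hy
    by_contra h
    exact hUA.le_bot ⟨h, hy⟩

/-- In a compact space, clopen subsets of `Z` can be chosen between the trace of a closed set and
that of an open neighbourhood of it. -/
theorem IsSeparating.of_hasSmallInductiveDimensionLT [CompactSpace X] {Z : Set X} (hZ : IsClosed Z)
    (h : HasSmallInductiveDimensionLT Z 1) : IsSeparating Z := by
  rw [hasSmallInductiveDimensionLT_one_iff] at h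
  intro K L hK hL hKL
  have : CompactSpace Z := isCompact_iff_compactSpace.1 hZ.isCompact
  have hKc : IsCompact ((↑) ⁻¹' K : Set Z) := (hK.preimage continuous_subtype_val).isCompact
  have hcov : ∀ x ∈ ((↑) ⁻¹' K : Set Z), ∃ C : Set Z, IsClopen C ∧ x ∈ C ∧ C ⊆ (↑) ⁻¹' Lᶜ := by
    intro x hx
    obtain ⟨C, hC, hxC, hCL⟩ := h.mem_nhds_iff.1
      ((hL.isOpen_compl.preimage continuous_subtype_val).mem_nhds
        (show x ∈ ((↑) ⁻¹' Lᶜ : Set Z) from fun h' => hKL.le_bot ⟨hx, h'⟩))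
    exact ⟨C, hC, hxC, hCL⟩
  choose! C hC hxC hCL using hcov
  obtain ⟨t, ht, hKt⟩ := hKc.elim_nhds_subcover C fun x hx => (hC x hx).isOpen.mem_nhds (hxC x hx)
  have hclopen : IsClopen (⋃ x ∈ t, C x) :=
    Set.Finite.isClopen_biUnion t.finite_toSet fun x hx => hC x (ht x hx)
  refine ⟨(↑) '' (⋃ x ∈ t, C x), (↑) '' (⋃ x ∈ t, C x)ᶜ,
    hZ.isClosedEmbedding_subtypeVal.isClosedMap _ hclopen.1,
    hZ.isClosedEmbedding_subtypeVal.isClosedMap _ hclopen.compl.1, ?_, ?_, ?_, ?_⟩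
  · rw [← Set.image_union, Set.union_compl_self, Set.image_univ, Subtype.range_coe]
  · exact (Set.disjoint_image_iff Subtype.val_injective).2 disjoint_compl_right
  · rw [Set.disjoint_left]
    rintro _ hx ⟨y, hy, rfl⟩
    exact hy (hKt hx)
  · rw [Set.disjoint_left]
    rintro _ hx ⟨y, hy, rfl⟩
    obtain ⟨z, hz, hyz⟩ := Set.mem_iUnion₂.1 hy
    exact hCL z (ht z hz) hyz hx

theorem exists_basis_isSeparating [CompactSpace X]
    (hdim : smallInductiveDimension X ≤ 1) :
    ∃ b : Set (Set X), TopologicalSpace.IsTopologicalBasis b ∧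
      ∀ U ∈ b, IsSeparating (frontier U) := by
  cases smallInductiveDimension_le_iff (n := 1).1 hdim with
  | succ _ b hb h =>
    exact ⟨b, hb, fun U hU => .of_hasSmallInductiveDimensionLT isClosed_frontier (h U hU)⟩

theorem frontier_biUnion_subset {ι : Type*} (s : Finset ι) (U : ι → Set X) :
    frontier (⋃ i ∈ s, U i) ⊆ ⋃ i ∈ s, frontier (U i) := by
  intro x hx
  rw [frontier, Finset.closure_biUnion] at hx
  obtain ⟨i, hi, hxi⟩ := Set.mem_iUnion₂.1 hx.1
  exact Set.mem_iUnion₂.2 ⟨i, hi, hxi, fun h =>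
    hx.2 (interior_mono (Set.subset_biUnion_of_mem (u := U) hi) h)⟩

variable [CompactSpace X] [T2Space X]

/-- A space with a basis of open sets with zero-dimensional boundaries has such sets between any
closed set and any open neighbourhood of it. -/
theorem exists_open_between {b : Set (Set X)} (hb : TopologicalSpace.IsTopologicalBasis b)
    (hb' : ∀ U ∈ b, IsSeparating (frontier U)) {K U : Set X} (hK : IsClosed K) (hU : IsOpen U)
    (hKU : K ⊆ U) :
    ∃ V, IsOpen V ∧ K ⊆ V ∧ closure V ⊆ U ∧ IsSeparating (frontier (closure V)) := by
  have hcov : ∀ x ∈ K, ∃ V ∈ b, x ∈ V ∧ closure V ⊆ U := fun x hx =>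
    hb.exists_closure_subset (hU.mem_nhds (hKU hx))
  choose! V hVb hxV hVU using hcov
  obtain ⟨t, ht, hKt⟩ := hK.isCompact.elim_nhds_subcover V fun x hx =>
    (hb.isOpen (hVb x hx)).mem_nhds (hxV x hx)
  refine ⟨⋃ x ∈ t, V x, isOpen_biUnion fun x hx => hb.isOpen (hVb x (ht x hx)), hKt, ?_, ?_⟩
  · rw [Finset.closure_biUnion]
    exact Set.iUnion₂_subset fun x hx => hVU x (ht x hx)
  · exact (IsSeparating.biUnion t fun x hx => hb' _ (hVb x (ht x hx))).mono isClosed_frontier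
      (frontier_closure_subset.trans (frontier_biUnion_subset _ _))

theorem exists_finite_cover {b : Set (Set X)} (hb : TopologicalSpace.IsTopologicalBasis b)
    {N : X → Set X} (hN : ∀ x, N x ∈ 𝓝 x) :
    ∃ (t : Finset X) (V : t → Set X), (∀ i, V i ∈ b) ∧ (∀ i, closure (V i) ⊆ N i) ∧
      ⋃ i, V i = Set.univ := by
  choose V hVb hxV hVN using fun x => hb.exists_closure_subset (hN x)
  obtain ⟨t, -, ht⟩ := isCompact_univ.elim_nhds_subcover V fun x _ =>
    (hb.isOpen (hVb x)).mem_nhds (hxV x)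
  refine ⟨t, fun i => V i, fun i => hVb i, fun i => hVN i, Set.eq_univ_of_univ_subset ?_⟩
  rwa [Set.iUnion_subtype]

/-- Pairwise disjoint closed sets have neighbourhoods with pairwise disjoint closures and
zero-dimensional boundaries. -/
theorem exists_open_disjoint_closure {b : Set (Set X)}
    (hb : TopologicalSpace.IsTopologicalBasis b) (hb' : ∀ U ∈ b, IsSeparating (frontier U))
    {κ : Type*} [Finite κ] {Z M : κ → Set X} (hZ : ∀ k, IsClosed (Z k)) (hM : ∀ k, IsOpen (M k))
    (hZM : ∀ k, Z k ⊆ M k) (hd : Pairwise fun k l => Disjoint (Z k) (Z l)) :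
    ∃ W : κ → Set X, (∀ k, IsOpen (W k)) ∧ (∀ k, Z k ⊆ W k) ∧ (∀ k, closure (W k) ⊆ M k) ∧
      (∀ k, IsSeparating (frontier (closure (W k)))) ∧
      Pairwise fun k l => Disjoint (closure (W k)) (closure (W l)) := by
  have hsep : ∀ k l, ∃ A B : Set X, k ≠ l → IsOpen A ∧ IsOpen B ∧ Z k ⊆ A ∧ Z l ⊆ B ∧
      Disjoint A B := by
    intro k l
    by_cases h : k = l
    · exact ⟨∅, ∅, fun h' => absurd h h'⟩
    · obtain ⟨A, B, h⟩ := normal_separation (hZ k) (hZ l) (hd h)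
      exact ⟨A, B, fun _ => h⟩
  choose A B hAB using hsep
  have hG : ∀ k, ∃ V, IsOpen V ∧ Z k ⊆ V ∧
      closure V ⊆ M k ∩ ⋂ l, ⋂ _ : l ≠ k, A k l ∩ B l k ∧ IsSeparating (frontier (closure V)) := by
    intro k
    refine exists_open_between hb hb' (hZ k) ((hM k).inter ?_) (Set.subset_inter (hZM k) ?_)
    · exact isOpen_iInter_of_finite fun l => isOpen_iInter_of_finite fun h =>
        (hAB k l h.symm).1.inter (hAB l k h).2.1
    · exact Set.subset_iInter₂ fun l h =>
        Set.subset_inter (hAB k l h.symm).2.2.1 (hAB l k h).2.2.2.1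
  choose W hW hZW hWG hWs using hG
  refine ⟨W, hW, hZW, fun k => (hWG k).trans Set.inter_subset_left, hWs, fun k l h => ?_⟩
  refine (hAB k l h).2.2.2.2.mono ?_ ?_
  · exact fun x hx => (Set.mem_iInter₂.1 (hWG k hx).2 l h.symm).1
  · exact fun x hx => (Set.mem_iInter₂.1 (hWG l hx).2 k h).2

/-- A closed zero-dimensional set covered by open sets is partitioned into finitely many closed
sets, each inside a member of the cover. -/
theorem IsSeparating.exists_partition {Z : Set X} (hZ : IsSeparating Z) {M : X → Set X}
    (hM : ∀ z, IsOpen (M z)) (hzM : ∀ z, z ∈ M z) :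
    ∃ (t : Finset X) (C : t → Set X), (∀ k, IsClosed (C k)) ∧ (∀ k, C k ⊆ M k) ∧ ⋃ k, C k = Z ∧
      Pairwise fun k l => Disjoint (C k) (C l) := by
  classical
  have key : ∀ (t : Finset X) (Y : Set X), IsSeparating Y → Y ⊆ ⋃ z ∈ t, M z →
      ∃ C : X → Set X, (∀ k ∈ t, IsClosed (C k)) ∧ (∀ k ∈ t, C k ⊆ M k) ∧ ⋃ k ∈ t, C k = Y ∧
        ∀ k ∈ t, ∀ l ∈ t, k ≠ l → Disjoint (C k) (C l) := by
    intro t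
    induction t using Finset.induction_on with
    | empty =>
      intro Y _ h
      exact ⟨fun _ => ∅, by simp, by simp, by simpa [eq_comm] using h, by simp⟩
    | insert a t ha ih =>
      intro Y hY hcov
      -- Split `Y` into a part inside `M a` and a part covered by the remaining open sets.
      obtain ⟨A, B, hA, hB, rfl, hd, hKB, hLA⟩ := hY (Y \ ⋃ z ∈ t, M z) (M a)ᶜ
        (hY.isClosed.sdiff (isOpen_biUnion fun z _ => hM z)) (hM a).isClosed_compl (by
          rw [Set.disjoint_left]
          intro x hx hxa
          obtain ⟨z, hz, hxz⟩ := Set.mem_iUnion₂.1 (hcov hx.1)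
          rcases Finset.mem_insert.1 hz with rfl | hz
          · exact hxa hxz
          · exact hx.2 (Set.mem_iUnion₂.2 ⟨z, hz, hxz⟩))
      obtain ⟨C, hC, hCM, hCB, hCd⟩ := ih B (hY.mono hB Set.subset_union_right) (by
        intro x hx
        by_contra h
        exact hKB.le_bot ⟨⟨Or.inr hx, h⟩, hx⟩)
      have hne : ∀ k ∈ t, k ≠ a := fun k hk h => ha (h ▸ hk)
      have hCt : ∀ k ∈ t, C k ⊆ B := fun k hk => hCB ▸ Set.subset_biUnion_of_mem (u := C) hk
      have hup : ∀ k ∈ t, Function.update C a A k = C k := fun k hk =>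
        Function.update_of_ne (hne k hk) _ _
      refine ⟨Function.update C a A, ?_, ?_, ?_, ?_⟩
      · intro k hk
        rcases Finset.mem_insert.1 hk with rfl | hk
        · simpa using hA
        · rw [hup k hk]
          exact hC k hk
      · intro k hk
        rcases Finset.mem_insert.1 hk with rfl | hk
        · rw [Function.update_self]
          intro x hx
          by_contra h
          exact hLA.le_bot ⟨h, hx⟩
        · rw [hup k hk]
          exact hCM k hk
      · rw [Finset.set_biUnion_insert, Function.update_self, Set.iUnion₂_congr hup, hCB]
      · intro k hk l hl hkl
        rcases Finset.mem_insert.1 hk with rfl | hk' <;>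
          rcases Finset.mem_insert.1 hl with rfl | hl'
        · exact absurd rfl hkl
        · rw [Function.update_self, hup l hl']
          exact hd.mono_right (hCt l hl')
        · rw [Function.update_self, hup k hk']
          exact (hd.mono_right (hCt k hk')).symm
        · rw [hup k hk', hup l hl']
          exact hCd k hk' l hl' hkl
  obtain ⟨t, -, ht⟩ := hZ.isClosed.isCompact.elim_nhds_subcover M fun z _ => (hM z).mem_nhds (hzM z)
  obtain ⟨C, hC, hCM, hCZ, hCd⟩ := key t Z hZ ht
  refine ⟨t, fun k => C k, fun k => hC k k.2, fun k => hCM k k.2, ?_, fun k l h =>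
    hCd k k.2 l l.2 fun h' => h (Subtype.ext h')⟩
  rw [← hCZ, Set.iUnion_subtype]

/-- In a space of dimension at most one, a finite cover `(Vᵢ)` by open sets with zero-dimensional
boundaries shrinks to a family `(Oᵢ)` with pairwise disjoint closures, which becomes a cover again
after adding finitely many arbitrarily small open sets `Wₖ`, also with pairwise disjoint
closures. -/
theorem exists_open_cover_two_families {b : Set (Set X)}
    (hb : TopologicalSpace.IsTopologicalBasis b) (hb' : ∀ U ∈ b, IsSeparating (frontier U))
    {ι : Type*} [Finite ι] {V : ι → Set X} (hVb : ∀ i, V i ∈ b) (hV : ⋃ i, V i = Set.univ)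
    {M : X → Set X} (hM : ∀ z, IsOpen (M z)) (hzM : ∀ z, z ∈ M z) :
    ∃ (t : Finset X) (O : ι → Set X) (W : t → Set X),
      (∀ i, IsOpen (O i)) ∧ (∀ i, O i ⊆ V i) ∧ (∀ i, IsSeparating (frontier (closure (O i)))) ∧
      (Pairwise fun i j => Disjoint (closure (O i)) (closure (O j))) ∧
      (∀ k, IsOpen (W k)) ∧ (∀ k, closure (W k) ⊆ M k) ∧
      (∀ k, IsSeparating (frontier (closure (W k)))) ∧
      (Pairwise fun k l => Disjoint (closure (W k)) (closure (W l))) ∧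
      ∀ x, (∃ i, x ∈ O i) ∨ ∃ k, x ∈ W k := by
  classical
  have := Fintype.ofFinite ι
  let _ : LinearOrder ι := LinearOrder.lift' (Fintype.equivFin ι) (Equiv.injective _)
  have hVo : ∀ i, IsOpen (V i) := fun i => hb.isOpen (hVb i)
  let D : ι → Set X := fun i => V i \ ⋃ j, ⋃ _ : j < i, closure (V j)
  have hD : ∀ i, IsOpen (D i) := fun i => (hVo i).sdiff
    (isClosed_iUnion_of_finite fun j => isClosed_iUnion_of_finite fun _ => isClosed_closure)
  have hDd : Pairwise fun i j => Disjoint (D i) (D j) := by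
    have hlt : ∀ i j, i < j → Disjoint (D i) (D j) := fun i j h => Set.disjoint_left.2
      fun x hi hj => hj.2 (Set.mem_iUnion₂.2 ⟨i, h, subset_closure hi.1⟩)
    intro i j h
    rcases lt_or_gt_of_ne h with h | h
    · exact hlt i j h
    · exact (hlt j i h).symm
  have hZ : IsSeparating (⋃ i, D i)ᶜ := by
    refine (IsSeparating.biUnion Finset.univ (Z := fun i => frontier (V i))
      fun i _ => hb' _ (hVb i)).mono (isOpen_iUnion hD).isClosed_compl ?_
    -- A point outside all `Dᵢ` is on the boundary of the first `Vᵢ` whose closure contains it.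
    intro x hx
    obtain ⟨j, hj⟩ := Set.mem_iUnion.1 (hV.symm ▸ Set.mem_univ x : x ∈ ⋃ i, V i)
    obtain ⟨i, hi, hmin⟩ := WellFounded.has_min (wellFounded_lt (α := ι)) {i | x ∈ closure (V i)}
      ⟨j, subset_closure hj⟩
    refine Set.mem_iUnion₂.2 ⟨i, Finset.mem_univ _, hi, fun h => hx (Set.mem_iUnion.2 ⟨i, ?_⟩)⟩
    refine ⟨interior_subset h, fun h' => ?_⟩
    obtain ⟨j, hj, hxj⟩ := Set.mem_iUnion₂.1 h'
    exact hmin j hxj hj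
  obtain ⟨t, C, hC, hCM, hCZ, hCd⟩ := hZ.exists_partition hM hzM
  obtain ⟨W, hW, hCW, hWM, hWs, hWd⟩ := exists_open_disjoint_closure hb hb' hC
    (fun k => hM k) hCM hCd
  have hcov : ∀ x, (∃ i, x ∈ D i) ∨ ∃ k, x ∈ W k := by
    intro x
    by_cases hx : x ∈ ⋃ i, D i
    · exact Or.inl (Set.mem_iUnion.1 hx)
    · obtain ⟨k, hk⟩ := Set.mem_iUnion.1 (hCZ.symm ▸ hx : x ∈ ⋃ k, C k)
      exact Or.inr ⟨k, hCW k hk⟩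
  -- As the `Dᵢ` are disjoint and the `Wₖ` cover the rest, `Dᵢ ∖ ⋃ Wₖ` is closed.
  have hO : ∀ i, ∃ O, IsOpen O ∧ D i \ ⋃ k, W k ⊆ O ∧ closure O ⊆ D i ∧
      IsSeparating (frontier (closure O)) := by
    intro i
    refine exists_open_between hb hb' ?_ (hD i) Set.sdiff_subset
    have : D i \ ⋃ k, W k = ((⋃ k, W k) ∪ ⋃ j, ⋃ _ : j ≠ i, D j)ᶜ := by
      ext x
      simp only [Set.mem_sdiff, Set.mem_compl_iff, Set.mem_union, not_or, Set.mem_iUnion]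
      constructor
      · rintro ⟨hx, hxW⟩
        exact ⟨hxW, fun ⟨j, hj, hxj⟩ => (hDd hj).le_bot ⟨hxj, hx⟩⟩
      · rintro ⟨hxW, hx⟩
        obtain ⟨j, hj⟩ := (hcov x).resolve_right hxW
        by_cases h : j = i
        · exact ⟨h ▸ hj, hxW⟩
        · exact absurd ⟨j, h, hj⟩ hx
    rw [this]
    exact ((isOpen_iUnion hW).union
      (isOpen_iUnion fun j => isOpen_iUnion fun _ => hD j)).isClosed_compl
  choose O hOo hDO hOD hOs using hO
  refine ⟨t, O, W, hOo, fun i => (subset_closure.trans (hOD i)).trans Set.sdiff_subset, hOs,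
    fun i j h => (hDd h).mono (hOD i) (hOD j), hW, hWM, hWs, hWd, fun x => ?_⟩
  by_cases hx : ∃ k, x ∈ W k
  · exact Or.inr hx
  · obtain ⟨i, hi⟩ := (hcov x).resolve_right hx
    exact Or.inl ⟨i, hDO i ⟨hi, fun h => hx (Set.mem_iUnion.1 h)⟩⟩

end topology

/-! ### Compact containment -/

section cu

variable {S : Type*} [AddCommMonoid S] [PartialOrder S] [IsCu S]

theorem zero_cc (a : S) : 0 ≪ a := fun _ _ _ _ _ => ⟨0, IsCu.zero_le _⟩

theorem CompactlyContained.exists_between {a b : S} (h : a ≪ b) : ∃ c, a ≪ c ∧ c ≪ b := by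
  obtain ⟨z, hz, hb⟩ := IsCu.exists_rapid b
  obtain ⟨n, hn⟩ := exists_cc_of_cc_isLUB hz.monotone hb h
  exact ⟨z n, hn, hz.cc hb n⟩

theorem IsCu.add_le_add {a b c d : S} (h : a ≤ b) (h' : c ≤ d) : a + c ≤ b + d := by
  refine (IsCu.add_le_add_right _ _ c h).trans ?_
  rw [add_comm b, add_comm b]
  exact IsCu.add_le_add_right _ _ b h'

/-- If `a ≪ x + y`, and `x`, `y` are suprema of rapidly increasing sequences `p`, `q`, then
`a ≪ pₙ + qₙ` for some `n`. -/
theorem exists_cc_add {p q : ℕ → S} (hp : RapidlyIncreasing p) (hq : RapidlyIncreasing q) {x y a : S}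
    (hx : IsLUB (Set.range p) x) (hy : IsLUB (Set.range q) y) (h : a ≪ x + y) :
    ∃ n, a ≪ p n + q n :=
  exists_cc_of_cc_isLUB (fun _ _ hmn => IsCu.add_le_add (hp.monotone hmn) (hq.monotone hmn))
    (IsCu.isLUB_add p q hp.monotone hq.monotone x y hx hy) h

/-- Finitely many elements way below `a` are simultaneously way below a member of any sequence
increasing to `a`. -/
theorem exists_forall_cc {ι : Type*} [Finite ι] {z : ℕ → S} (hz : Monotone z) {a : S}
    (ha : IsLUB (Set.range z) a) (P : ι → Prop) (s : ι → S) (hs : ∀ i, P i → s i ≪ a) :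
    ∃ n, ∀ i, P i → s i ≪ z n := by
  classical
  have := Fintype.ofFinite ι
  choose! m hm using fun i (h : P i) => exists_cc_of_cc_isLUB hz ha (hs i h)
  exact ⟨Finset.univ.sup m, fun i h =>
    (hm i h).trans_le (hz (Finset.le_sup (f := m) (Finset.mem_univ i)))⟩

end cu

namespace CuPresheaf

variable {X : Type u} [TopologicalSpace X] (S : CuPresheaf.{u, v} X) [Nonempty X]

/-! ### Fibers and continuous sections -/

theorem toFiber_eq_of (x : X) (V : ClosedNhd x) (s : S.global) :
    S.toFiber x s = CuLimit.of (S.nhdRes x) V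
      (S.res (V := ClosedRegion.whole X) (W := V.toRegion) (Set.subset_univ _) s) :=
  ((CuLimit.isCuLimit.{0, u, v} (f := S.nhdRes x)).1 (ClosedNhd.whole x) V (Set.subset_univ _) s).symm

/-- Compact containment at a point spreads to a neighbourhood, at the price of shrinking the
smaller element. -/
theorem eventually_toFiber_cc {x : X} {s s' t : S.global} (hs : s ≪ s')
    (h : S.toFiber x s' ≪ S.toFiber x t) : ∀ᶠ y in 𝓝 x, S.toFiber y s ≪ S.toFiber y t := by
  obtain ⟨c, hc, hs'⟩ := Completion.cc_iff.1 h
  -- On the level of germs `s ≺ c ≺ t`.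
  have h0 : germPrec (⟦⟨ClosedNhd.whole x, s⟩⟧ : DirectLimit _ (S.nhdRes x))
      ⟦⟨ClosedNhd.whole x, s'⟩⟧ := ⟨ClosedNhd.whole x, s, s', rfl, rfl, hs⟩
  have h1 : (⟦⟨ClosedNhd.whole x, s⟩⟧ : DirectLimit _ (S.nhdRes x)) ≺
      ⟦⟨ClosedNhd.whole x, t⟩⟧ := PrecMonoid.trans _ _ _ (hs' h0) hc
  obtain ⟨V, hV, h2⟩ := germPrec_mk.1 h1
  filter_upwards [isOpen_interior.mem_nhds V.mem_interior] with y hy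
  rw [S.toFiber_eq_of y ⟨V.carrier, V.isClosed, hy⟩, S.toFiber_eq_of y ⟨V.carrier, V.isClosed, hy⟩]
  exact (CuLimit.of (S.nhdRes y) ⟨V.carrier, V.isClosed, hy⟩).map_cc h2

/-- If all restriction maps are surjective, then global elements are dense in each fiber. -/
theorem IsSurjective.exists_rapid {S : CuPresheaf.{u, v} X} (hS : S.IsSurjective) {x : X}
    (a : S.Fiber x) : ∃ r : ℕ → S.global, (RapidlyIncreasing fun n => S.toFiber x (r n)) ∧
      IsLUB (Set.range fun n => S.toFiber x (r n)) a := by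
  have hsurj : ∀ c : DirectLimit _ (S.nhdRes x), ∃ s : S.global,
      c = ⟦⟨ClosedNhd.whole x, s⟩⟧ := by
    intro c
    obtain ⟨V, p, rfl⟩ := DirectLimit.exists_eq_mk _ c
    obtain ⟨s, rfl⟩ := hS (V := ClosedRegion.whole X) (W := V.toRegion) (Set.subset_univ _) p
    exact ⟨s, DirectLimit.mk_apply (f := S.nhdRes x) (ClosedNhd.whole x) V s (Set.subset_univ _)⟩
  obtain ⟨z, hz, -, -, hl⟩ := Completion.exists_isLUB_of a
  choose r hr using fun n => hsurj (z n)
  have he : ∀ n, S.toFiber x (r n) = Completion.of (z n) := fun n => by rw [hr]; rfl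
  refine ⟨r, fun n => ?_, ?_⟩
  · simp only [he]
    exact Completion.of_cc (hz n)
  · simpa only [he] using hl

/-- Continuity of a section is lower semicontinuity: what lies way below `f x` lies, after
shrinking it, way below `f` in a neighbourhood of `x`. -/
theorem isContinuousSection_iff {f : ∀ x, S.Fiber x} : S.IsContinuousSection f ↔
    ∀ x (s s' : S.global), s ≪ s' → S.toFiber x s' ≪ f x → ∀ᶠ y in 𝓝 x, S.toFiber y s ≪ f y := by
  constructor
  · intro h x s s' hs hx
    have ho : IsOpen (S.basicOpen Set.univ s) :=
      TopologicalSpace.isOpen_generateFrom_of_mem ⟨Set.univ, s, isOpen_univ, rfl⟩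
    filter_upwards [(ho.preimage h).mem_nhds (show x ∈ _ from ⟨trivial, s', hs, hx⟩)] with y hy
    obtain ⟨-, t, ht, hty⟩ := hy
    exact hty.le_trans ((S.toFiber y).monotone ht.le)
  · intro h
    refine continuous_generateFrom_iff.2 ?_
    rintro _ ⟨U, s, hU, rfl⟩
    refine isOpen_iff_mem_nhds.2 ?_
    rintro x ⟨hxU, s', hs, hx⟩
    obtain ⟨t, hst, hts⟩ := hs.exists_between
    filter_upwards [hU.mem_nhds hxU, h x t s' hts hx] with y hyU hy
    exact ⟨hyU, t, hst, hy⟩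

theorem isContinuousSection_toFiber (s : S.global) :
    S.IsContinuousSection fun x => S.toFiber x s :=
  S.isContinuousSection_iff.2 fun _ _ _ hs h => S.eventually_toFiber_cc hs h

variable {S}

theorem IsContinuousSection.eventually {f : ∀ x, S.Fiber x} (hf : S.IsContinuousSection f) {x : X}
    {s s' : S.global} (hs : s ≪ s') (h : S.toFiber x s' ≪ f x) :
    ∀ᶠ y in 𝓝 x, S.toFiber y s ≪ f y :=
  S.isContinuousSection_iff.1 hf x s s' hs h

/-- Finitely many global elements that are way below `f` at `x` are dominated by a single one. -/
theorem IsSurjective.exists_forall_toFiber_cc (hS : S.IsSurjective) {ι : Type*} [Finite ι] {x : X}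
    {a : S.Fiber x} (P : ι → Prop) (s : ι → S.global) (hs : ∀ i, P i → S.toFiber x (s i) ≪ a) :
    ∃ r r' : S.global, r ≪ r' ∧ S.toFiber x r' ≪ a ∧
      ∀ i, P i → S.toFiber x (s i) ≪ S.toFiber x r := by
  obtain ⟨ρ, hρ, ha⟩ := hS.exists_rapid a
  obtain ⟨n, hn⟩ := exists_forall_cc hρ.monotone ha P (fun i => S.toFiber x (s i)) hs
  obtain ⟨z, hz, hl⟩ := IsCu.exists_rapid (ρ n)
  obtain ⟨m, hm⟩ := exists_forall_cc ((S.toFiber x).monotone.comp hz.monotone)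
    ((S.toFiber x).map_isLUB hz.monotone hl) P (fun i => S.toFiber x (s i)) hn
  exact ⟨z m, ρ n, hz.cc hl m, hρ.cc ha n, hm⟩

theorem IsContinuousSection.add (hS : S.IsSurjective) {f g : ∀ x, S.Fiber x}
    (hf : S.IsContinuousSection f) (hg : S.IsContinuousSection g) : S.IsContinuousSection (f + g) := by
  refine S.isContinuousSection_iff.2 fun x s s' hs h => ?_
  obtain ⟨p, hp, hpl⟩ := hS.exists_rapid (f x)
  obtain ⟨q, hq, hql⟩ := hS.exists_rapid (g x)
  obtain ⟨n, hn⟩ := exists_cc_add hp hq hpl hql h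
  obtain ⟨y, hy, hyl⟩ := IsCu.exists_rapid (p n)
  obtain ⟨z, hz, hzl⟩ := IsCu.exists_rapid (q n)
  have hl := IsCu.isLUB_add y z hy.monotone hz.monotone _ _ hyl hzl
  have hm : Monotone fun n => y n + z n :=
    fun _ _ h => IsCu.add_le_add (hy.monotone h) (hz.monotone h)
  rw [← map_add] at hn
  obtain ⟨m, hm⟩ := exists_cc_of_cc_isLUB ((S.toFiber x).monotone.comp hm)
    ((S.toFiber x).map_isLUB hm hl) hn
  filter_upwards [S.eventually_toFiber_cc hs hm, hf.eventually (hy.cc hyl m) (hp.cc hpl n),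
    hg.eventually (hz.cc hzl m) (hq.cc hql n)] with w h1 h2 h3
  rw [map_add] at h1
  exact h1.trans_le (IsCu.add_le_add h2.le h3.le)

theorem IsContinuousSection.zero : S.IsContinuousSection (0 : ∀ x, S.Fiber x) := by
  have := S.isContinuousSection_toFiber 0
  simp only [map_zero] at this
  exact this

theorem IsContinuousSection.of_isLUB {z : ℕ → ∀ x, S.Fiber x} (hz : Monotone z)
    (hc : ∀ n, S.IsContinuousSection (z n)) {f : ∀ x, S.Fiber x}
    (hf : ∀ x, IsLUB (Set.range fun n => z n x) (f x)) : S.IsContinuousSection f := by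
  refine S.isContinuousSection_iff.2 fun x s s' hs h => ?_
  obtain ⟨n, hn⟩ := exists_cc_of_cc_isLUB (fun i j hij => hz hij x) (hf x) h
  filter_upwards [(hc n).eventually hs hn] with y hy
  exact hy.trans_le ((hf y).1 ⟨n, rfl⟩)

/-- The submonoid of continuous sections. -/
def sections (hS : S.IsSurjective) : AddSubmonoid (∀ x, S.Fiber x) where
  carrier := {f | S.IsContinuousSection f}
  add_mem' hf hg := IsContinuousSection.add hS hf hg
  zero_mem' := IsContinuousSection.zero

/-- Suprema of increasing sequences of continuous sections are pointwise. -/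
theorem exists_isLUB_sections (hS : S.IsSurjective) {z : ℕ → sections hS} (hz : Monotone z) :
    ∃ b : sections hS, IsLUB (Set.range z) b ∧
      ∀ x, IsLUB (Set.range fun n => (z n).1 x) (b.1 x) := by
  choose f hf using fun x => IsCu.exists_isLUB (fun n => (z n).1 x) fun _ _ h => hz h x
  refine ⟨⟨f, IsContinuousSection.of_isLUB (z := fun n => (z n).1) hz (fun n => (z n).2) hf⟩,
    ⟨?_, fun c hc x => (hf x).2 ?_⟩, hf⟩
  · rintro _ ⟨n, rfl⟩ x
    exact (hf x).1 ⟨n, rfl⟩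
  · rintro _ ⟨n, rfl⟩
    exact hc ⟨n, rfl⟩ x

theorem isLUB_sections_iff (hS : S.IsSurjective) {z : ℕ → sections hS} (hz : Monotone z)
    {b : sections hS} :
    IsLUB (Set.range z) b ↔ ∀ x, IsLUB (Set.range fun n => (z n).1 x) (b.1 x) := by
  obtain ⟨c, hc, hcx⟩ := exists_isLUB_sections hS hz
  constructor
  · intro h
    rwa [h.unique hc]
  · intro h
    rwa [show b = c from Subtype.ext (funext fun x => (h x).unique (hcx x))]

/-! ### Local compact containment -/

/-- The section `g` is locally way below `f`: near each point a pair `s ≪ s'` of global elements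
separates `g` from `f`. -/
def LocallyBelow (g f : ∀ x, S.Fiber x) : Prop :=
  ∀ x, ∃ s s' : S.global, s ≪ s' ∧ (∀ᶠ y in 𝓝 x, g y ≤ S.toFiber y s) ∧ S.toFiber x s' ≪ f x

theorem LocallyBelow.le {g f : ∀ x, S.Fiber x} (h : LocallyBelow g f) : g ≤ f := by
  intro x
  obtain ⟨s, s', hs, hg, hf⟩ := h x
  exact (hg.self_of_nhds.trans ((S.toFiber x).monotone hs.le)).trans hf.le

theorem LocallyBelow.mono {g' g f : ∀ x, S.Fiber x} (h : LocallyBelow g f) (hg' : g' ≤ g) :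
    LocallyBelow g' f := by
  intro x
  obtain ⟨s, s', hs, hg, hf⟩ := h x
  exact ⟨s, s', hs, hg.mono fun y hy => (hg' y).trans hy, hf⟩

theorem LocallyBelow.zero (f : ∀ x, S.Fiber x) : LocallyBelow 0 f := fun x =>
  ⟨0, 0, zero_cc _, Eventually.of_forall fun y => by simp, by rw [map_zero]; exact zero_cc _⟩

theorem LocallyBelow.add {g f g' f' : ∀ x, S.Fiber x} (h : LocallyBelow g f)
    (h' : LocallyBelow g' f') : LocallyBelow (g + g') (f + f') := by
  intro x
  obtain ⟨s, t, hs, hg, hf⟩ := h x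
  obtain ⟨s', t', hs', hg', hf'⟩ := h' x
  refine ⟨s + s', t + t', IsCu.add_compactlyContained _ _ _ _ hs hs', ?_, ?_⟩
  · filter_upwards [hg, hg'] with y hy hy'
    rw [map_add]
    exact IsCu.add_le_add hy hy'
  · rw [map_add]
    exact IsCu.add_compactlyContained _ _ _ _ hf hf'

/-- By compactness of `X`, local compact containment implies compact containment. -/
theorem LocallyBelow.cc [CompactSpace X] (hS : S.IsSurjective) {g f : sections hS}
    (h : LocallyBelow g.1 f.1) : g ≪ f := by
  intro z hz b hb hfb
  rw [isLUB_sections_iff hS hz] at hb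
  have hloc : ∀ x, ∃ n, ∀ᶠ y in 𝓝 x, g.1 y ≤ (z n).1 y := by
    intro x
    obtain ⟨s, s', hs, hg, hf⟩ := h x
    obtain ⟨n, hn⟩ := exists_cc_of_cc_isLUB (fun i j hij => hz hij x) (hb x)
      (hf.trans_le (hfb x))
    refine ⟨n, ?_⟩
    filter_upwards [hg, (z n).2.eventually hs hn] with y h1 h2
    exact h1.trans h2.le
  choose n hn using hloc
  obtain ⟨t, -, ht⟩ := isCompact_univ.elim_nhds_subcover (fun x => {y | g.1 y ≤ (z (n x)).1 y})
    fun x _ => hn x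
  refine ⟨t.sup n, fun y => ?_⟩
  obtain ⟨x, hx, hy⟩ := Set.mem_iUnion₂.1 (ht (Set.mem_univ y))
  exact le_trans hy (hz (Finset.le_sup (f := n) hx) y)

/-! ### Piecewise characteristic sections -/

/-- Piecewise characteristic sections may be given by a cover with any finite index set. -/
theorem isPiecewiseCharacteristic_of_fintype {ι : Type*} [Fintype ι] {g : ∀ x, S.Fiber x}
    (U : ι → Set X) (s : ι → S.global) (t : Sym2 ι → S.global) (hU : ∀ i, IsOpen (U i))
    (hcov : ∀ x, ∃ i, x ∈ U i) (hmult : ∀ x, {i | x ∈ U i}.ncard ≤ 2)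
    (hmult' : ∀ x, {i | x ∈ closure (U i)}.ncard ≤ 2)
    (hdim : ∀ i, smallInductiveDimension (frontier (closure (U i))) ≤ 0)
    (hle : ∀ i j, i ≠ j → ∀ x ∈ closure (frontier (U i ∩ U j) ∩ U i),
      S.toFiber x (s i) ≤ S.toFiber x (t s(i, j)))
    (hg : ∀ i, ∀ x ∈ U i, (∀ j, j ≠ i → x ∉ U j) → g x = S.toFiber x (s i))
    (hg' : ∀ i j, i ≠ j → ∀ x ∈ U i ∩ U j, g x = S.toFiber x (t s(i, j))) :
    S.IsPiecewiseCharacteristic g := by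
  let e := (Fintype.equivFin ι).symm
  have hcard : ∀ P : ι → Prop, {i | P (e i)}.ncard = {i | P i}.ncard := fun P =>
    Set.ncard_preimage_of_injective_subset_range e.injective fun i _ => e.surjective i
  refine ⟨_, fun i => U (e i), fun i => s (e i), fun p => t (p.map e), fun i => hU _, ?_,
    fun x => ?_, fun x => ?_, fun i => hdim _, fun i j h x hx => ?_, fun i x hx h => ?_,
    fun i j h x hx => ?_⟩
  · refine Set.eq_univ_of_forall fun x => ?_
    obtain ⟨i, hi⟩ := hcov x
    exact Set.mem_iUnion.2 ⟨e.symm i, by simpa using hi⟩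
  · exact (hcard fun i => x ∈ U i).trans_le (hmult x)
  · exact (hcard fun i => x ∈ closure (U i)).trans_le (hmult' x)
  · exact hle _ _ (e.injective.ne h) x hx
  · refine hg _ x hx fun j hj hxj => h (e.symm j) (fun h' => hj ?_) (by simpa using hxj)
    rw [← h', Equiv.apply_symm_apply]
  · exact hg' _ _ (e.injective.ne h) x hx

theorem encard_setOf_mem_le_one {α Y : Type*} {O : α → Set Y}
    (hO : Pairwise fun i j => Disjoint (O i) (O j)) (x : Y) : {i | x ∈ O i}.encard ≤ 1 :=
  Set.encard_le_one_iff.2 fun _ _ hi hj => hO.eq fun hd => hd.le_bot ⟨hi, hj⟩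

theorem ncard_sum_le_two {α β Y : Type*} {O : α → Set Y} {W : β → Set Y}
    (hO : Pairwise fun i j => Disjoint (O i) (O j)) (hW : Pairwise fun i j => Disjoint (W i) (W j))
    (x : Y) : {i | x ∈ Sum.elim O W i}.ncard ≤ 2 := by
  have he : {i | x ∈ Sum.elim O W i} = Sum.inl '' {i | x ∈ O i} ∪ Sum.inr '' {i | x ∈ W i} := by
    ext (i | i) <;> simp
  refine ENat.toNat_le_of_le_natCast ?_
  calc {i | x ∈ Sum.elim O W i}.encard
      ≤ {i | x ∈ O i}.encard + {i | x ∈ W i}.encard := by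
        rw [he]
        refine (Set.encard_union_le _ _).trans ?_
        rw [Sum.inl_injective.encard_image, Sum.inr_injective.encard_image]
    _ ≤ 1 + 1 := _root_.add_le_add (encard_setOf_mem_le_one hO x)
        (encard_setOf_mem_le_one hW x)
    _ = (2 : ℕ) := by norm_num

/-! ### Gluing local approximations -/

/-- Let finitely many pairs `sᵢ ≪ s'ᵢ` with `s'ᵢ` way below `f` on the closed sets `Kᵢ` be given.
Near each point, a single pair `r ≪ r'` with `r'` way below `f` dominates all `sᵢ` on `Kᵢ`. -/
theorem IsContinuousSection.exists_local_upper_bound (hS : S.IsSurjective) {f : ∀ x, S.Fiber x}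
    (hf : S.IsContinuousSection f) {ι : Type*} [Finite ι] {K : ι → Set X} (hK : ∀ i, IsClosed (K i))
    {s s' : ι → S.global} (hs : ∀ i, s i ≪ s' i) (hsf : ∀ i, ∀ y ∈ K i, S.toFiber y (s' i) ≪ f y)
    (x : X) :
    ∃ (r r' : S.global) (N : Set X), r ≪ r' ∧ IsOpen N ∧ x ∈ N ∧ (∀ y ∈ N, S.toFiber y r' ≪ f y) ∧
      ∀ i, ∀ y ∈ N ∩ K i, S.toFiber y (s i) ≤ S.toFiber y r := by
  obtain ⟨r, r'', hr, hrf, hsr⟩ := hS.exists_forall_toFiber_cc (fun i => x ∈ K i) s'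
    fun i hi => hsf i x hi
  obtain ⟨r', hr', hr''⟩ := hr.exists_between
  have h : ∀ i, ∀ᶠ y in 𝓝 x, y ∈ K i → S.toFiber y (s i) ≤ S.toFiber y r := by
    intro i
    by_cases hi : x ∈ K i
    · filter_upwards [S.eventually_toFiber_cc (hs i) (hsr i hi)] with y hy _
      exact hy.le
    · filter_upwards [(hK i).isOpen_compl.mem_nhds hi] with y hy hy'
      exact absurd hy' hy
  obtain ⟨N, hN, hNo, hxN⟩ := eventually_nhds_iff.1
    ((hf.eventually hr'' hrf).and (eventually_all.2 h))
  exact ⟨r, r', N, hr', hNo, hxN, fun y hy => (hN y hy).1, fun i y hy => (hN y hy.1).2 i hy.2⟩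

/-- The gluing of sections `rᵢ` on a disjoint family `(Oᵢ)` with sections `qₖ` on a disjoint family
`(Wₖ)`, the latter taking precedence on overlaps. -/
theorem exists_glue {ι κ : Type*} {O : ι → Set X} {W : κ → Set X}
    (hO : Pairwise fun i j => Disjoint (O i) (O j)) (hW : Pairwise fun k l => Disjoint (W k) (W l))
    (r : ι → S.global) (q : κ → S.global) :
    ∃ g : ∀ x, S.Fiber x, (∀ k, ∀ x ∈ W k, g x = S.toFiber x (q k)) ∧
      ∀ i, ∀ x ∈ O i, (∀ k, x ∉ W k) → g x = S.toFiber x (r i) := by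
  classical
  refine ⟨fun x => if h : ∃ k, x ∈ W k then S.toFiber x (q h.choose) else
    if h : ∃ i, x ∈ O i then S.toFiber x (r h.choose) else 0, fun k x hx => ?_, fun i x hx h => ?_⟩
  · have h : ∃ k, x ∈ W k := ⟨k, hx⟩
    have e : h.choose = k := hW.eq fun hd => hd.le_bot ⟨h.choose_spec, hx⟩
    simp only [dif_pos h, e]
  · have h' : ¬ ∃ k, x ∈ W k := fun ⟨k, hk⟩ => h k hk
    have h'' : ∃ i, x ∈ O i := ⟨i, hx⟩
    have e : h''.choose = i := hO.eq fun hd => hd.le_bot ⟨h''.choose_spec, hx⟩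
    simp only [dif_neg h', dif_pos h'', e]

variable [CompactSpace X] [T2Space X]

/-- The approximation step: finitely many local lower bounds of a continuous section `f` are
dominated by a piecewise characteristic section that is locally way below `f`. -/
theorem IsContinuousSection.exists_piecewiseCharacteristic (hS : S.IsSurjective)
    (hdim : smallInductiveDimension X ≤ 1) {f : ∀ x, S.Fiber x}
    (hf : S.IsContinuousSection f) {ι : Type*} [Finite ι] {K : ι → Set X} (hK : ∀ i, IsClosed (K i))
    {s s' : ι → S.global} (hs : ∀ i, s i ≪ s' i)
    (hsf : ∀ i, ∀ y ∈ K i, S.toFiber y (s' i) ≪ f y) :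
    ∃ g, S.IsContinuousSection g ∧ S.IsPiecewiseCharacteristic g ∧ LocallyBelow g f ∧
      ∀ i, ∀ y ∈ K i, S.toFiber y (s i) ≤ g y := by
  obtain ⟨b, hb, hb'⟩ := exists_basis_isSeparating hdim
  choose r r' N hr hNo hxN hrf hsr using hf.exists_local_upper_bound hS hK hs hsf
  obtain ⟨τ, V, hVb, hVN, hV⟩ := exists_finite_cover hb fun x => (hNo x).mem_nhds (hxN x)
  -- The elements `qₖ` have to dominate the `sᵢ` as well as the elements `rⱼ`.
  choose q q' M hq hMo hxM hqf hsq using hf.exists_local_upper_bound hS (ι := ι ⊕ τ)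
    (K := Sum.elim K fun j => closure (V j)) (s := Sum.elim s fun j => r j)
    (s' := Sum.elim s' fun j => r' j)
    (by rintro (i | j); exacts [hK i, isClosed_closure])
    (by rintro (i | j); exacts [hs i, hr j])
    (by rintro (i | j) y hy; exacts [hsf i y hy, hrf j y (hVN j hy)])
  obtain ⟨t, O, W, hO, hOV, hOs, hOd, hW, hWM, hWs, hWd, hcov⟩ :=
    exists_open_cover_two_families hb hb' hVb hV hMo hxM
  have hOd' : Pairwise fun i j => Disjoint (O i) (O j) :=
    fun i j h => (hOd h).mono subset_closure subset_closure
  have hWd' : Pairwise fun i j => Disjoint (W i) (W j) :=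
    fun i j h => (hWd h).mono subset_closure subset_closure
  have hrq : ∀ (i : τ) (k : t), ∀ y ∈ closure (O i), y ∈ closure (W k) →
      S.toFiber y (r i) ≤ S.toFiber y (q k) := fun i k y hy hy' =>
    hsq k (Sum.inr i) y ⟨hWM k hy', closure_mono (hOV i) hy⟩
  obtain ⟨g, hgW, hgO⟩ := exists_glue hOd' hWd' (fun i : τ => r i) (fun k : t => q k)
  have hgr : ∀ i, ∀ y ∈ O i, S.toFiber y (r i) ≤ g y := by
    intro i y hy
    by_cases h : ∃ k, y ∈ W k
    · obtain ⟨k, hk⟩ := h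
      rw [hgW k y hk]
      exact hrq i k y (subset_closure hy) (subset_closure hk)
    · exact (hgO i y hy fun k hk => h ⟨k, hk⟩).ge
  refine ⟨g, ?_, ?_, ?_, ?_⟩
  · refine S.isContinuousSection_iff.2 fun x p p' hp h => ?_
    by_cases hx : ∃ k, x ∈ W k
    · obtain ⟨k, hk⟩ := hx
      rw [hgW k x hk] at h
      filter_upwards [(hW k).mem_nhds hk, S.eventually_toFiber_cc hp h] with y hy hy'
      rwa [hgW k y hy]
    · obtain ⟨i, hi⟩ := (hcov x).resolve_right hx
      rw [hgO i x hi fun k hk => hx ⟨k, hk⟩] at h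
      filter_upwards [(hO i).mem_nhds hi, S.eventually_toFiber_cc hp h] with y hy hy'
      exact hy'.trans_le (hgr i y hy)
  · have hcl : ∀ i, closure (Sum.elim O W i) =
        Sum.elim (fun i => closure (O i)) (fun k => closure (W k)) i := by
      rintro (i | k) <;> rfl
    refine isPiecewiseCharacteristic_of_fintype (ι := τ ⊕ t) (Sum.elim O W)
      (Sum.elim (fun i => r i) fun k => q k)
      -- The element attached to `Oᵢ ∩ Wₖ` is `qₖ`; all other intersections are empty.
      (Sym2.lift ⟨fun a c => Sum.elim (fun _ => Sum.elim (fun _ => 0) (fun k => q k) c)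
        (fun k => Sum.elim (fun _ => q k) (fun _ => 0) c) a, by rintro (i | k) (j | l) <;> rfl⟩)
      ?_ ?_ (ncard_sum_le_two hOd' hWd') ?_ ?_ ?_ ?_ ?_
    · rintro (i | k)
      exacts [hO i, hW k]
    · intro x
      rcases hcov x with ⟨i, hi⟩ | ⟨k, hk⟩
      exacts [⟨Sum.inl i, hi⟩, ⟨Sum.inr k, hk⟩]
    · simpa only [hcl] using ncard_sum_le_two hOd hWd
    · rintro (i | k)
      exacts [(hOs i).smallInductiveDimension_le, (hWs k).smallInductiveDimension_le]
    · rintro (i | k) (j | l) h x hx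
      · simp [(hOd' fun h' => h (congrArg _ h')).inter_eq] at hx
      · have hx' := closure_minimal (Set.inter_subset_left.trans frontier_subset_closure)
          isClosed_closure hx
        exact hrq i l x (closure_mono Set.inter_subset_left hx')
          (closure_mono Set.inter_subset_right hx')
      · exact le_rfl
      · simp [(hWd' fun h' => h (congrArg _ h')).inter_eq] at hx
    · rintro (i | k) x hx h
      · exact hgO i x hx fun k => h (Sum.inr k) (by simp)
      · exact hgW k x hx
    · rintro (i | k) (j | l) h x hx
      · exact absurd hx.2 ((hOd' fun h' => h (congrArg _ h')).notMem_of_mem_left hx.1)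
      · exact hgW l x hx.2
      · exact hgW k x hx.1
      · exact absurd hx.2 ((hWd' fun h' => h (congrArg _ h')).notMem_of_mem_left hx.1)
  · intro x
    by_cases hx : ∃ k, x ∈ closure (W k)
    · obtain ⟨k, hk⟩ := hx
      refine ⟨q k, q' k, hq k, ?_, hqf k x (hWM k hk)⟩
      -- Near `x`, only `Wₖ` matters, and `g` is below `q̂ₖ` also outside of `Wₖ`.
      have hother : ∀ᶠ y in 𝓝 x, ∀ l, l ≠ k → y ∉ W l := by
        refine eventually_all.2 fun l => ?_
        by_cases h : l = k
        · exact Eventually.of_forall fun y h' => absurd h h'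
        · filter_upwards [isClosed_closure.isOpen_compl.mem_nhds
            ((hWd h).notMem_of_mem_right hk)] with y hy _ hy'
          exact hy (subset_closure hy')
      rcases hcov x with ⟨i, hi⟩ | ⟨l, hl⟩
      · filter_upwards [hother, (hO i).mem_nhds hi, (hMo k).mem_nhds (hWM k hk)] with y h1 h2 h3
        by_cases hyW : y ∈ W k
        · exact (hgW k y hyW).le
        · rw [hgO i y h2 fun l hl => h1 l (fun h => hyW (h ▸ hl)) hl]
          exact hsq k (Sum.inr i) y ⟨h3, subset_closure (hOV i h2)⟩
      · have : l = k := hWd.eq fun hd => hd.le_bot ⟨subset_closure hl, hk⟩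
        subst this
        filter_upwards [(hW l).mem_nhds hl] with y hy
        exact (hgW l y hy).le
    · obtain ⟨i, hi⟩ := (hcov x).resolve_right fun ⟨k, hk⟩ => hx ⟨k, subset_closure hk⟩
      refine ⟨r i, r' i, hr i, ?_, hrf i x (hVN i (subset_closure (hOV i hi)))⟩
      have : ∀ᶠ y in 𝓝 x, ∀ k, y ∉ W k := by
        refine eventually_all.2 fun k => ?_
        filter_upwards [isClosed_closure.isOpen_compl.mem_nhds fun h => hx ⟨k, h⟩] with y hy hy'
        exact hy (subset_closure hy')
      filter_upwards [this, (hO i).mem_nhds hi] with y h1 h2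
      exact (hgO i y h2 h1).le
  · intro i y hy
    by_cases h : ∃ k, y ∈ W k
    · obtain ⟨k, hk⟩ := h
      rw [hgW k y hk]
      exact hsq k (Sum.inl i) y ⟨hWM k (subset_closure hk), hy⟩
    · obtain ⟨j, hj⟩ := (hcov y).resolve_right h
      rw [hgO j y hj fun k hk => h ⟨k, hk⟩]
      exact hsr j i y ⟨hVN j (subset_closure (hOV j hj)), hy⟩

/-- Interpolation: between `g` and `f` with `g` locally way below `f` there is a piecewise
characteristic section, which moreover dominates a prescribed local lower bound of `f`. -/
theorem LocallyBelow.exists_piecewiseCharacteristic_between (hS : S.IsSurjective)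
    (hdim : smallInductiveDimension X ≤ 1) {g f : ∀ x, S.Fiber x}
    (hf : S.IsContinuousSection f) (hgf : LocallyBelow g f) {K : Set X} (hK : IsClosed K)
    {s s' : S.global} (hs : s ≪ s') (hsf : ∀ y ∈ K, S.toFiber y s' ≪ f y) :
    ∃ h, S.IsContinuousSection h ∧ S.IsPiecewiseCharacteristic h ∧ LocallyBelow g h ∧
      LocallyBelow h f ∧ ∀ y ∈ K, S.toFiber y s ≤ h y := by
  -- With `p ≪ p₁ ≪ p₂ ≪ p₃ ≪ p'`, the pair `p ≪ p₁` will separate `g` from `h`, where `h` is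
  -- constructed to dominate `p₂`, and `p₃` is still way below `f` in a neighbourhood.
  choose p p' hp hgp hpf using hgf
  choose p₃ hp₃ hpp' using fun x => (hp x).exists_between
  choose p₂ hp₂ hp₂₃ using fun x => (hp₃ x).exists_between
  choose p₁ hp₁ hp₁₂ using fun x => (hp₂ x).exists_between
  obtain ⟨t, V, hVo, hVN, hV⟩ := exists_finite_cover
    (TopologicalSpace.isTopologicalBasis_opens (α := X))
    fun x => (hgp x).and (hf.eventually (hpp' x) (hpf x))
  obtain ⟨h, hh, hpc, hhf, hle⟩ := hf.exists_piecewiseCharacteristic hS hdim (ι := Option t)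
    (K := fun i => i.elim K fun j => closure (V j)) (s := fun i => i.elim s fun j => p₂ j)
    (s' := fun i => i.elim s' fun j => p₃ j)
    (by rintro (_ | j); exacts [hK, isClosed_closure])
    (by rintro (_ | j); exacts [hs, hp₂₃ j])
    (by rintro (_ | j) y hy; exacts [hsf y hy, (hVN j hy).2])
  refine ⟨h, hh, hpc, fun x => ?_, hhf, hle none⟩
  obtain ⟨i, hi⟩ := Set.mem_iUnion.1 (hV.symm ▸ Set.mem_univ x : x ∈ ⋃ i, V i)
  refine ⟨p i, p₁ i, hp₁ i, ?_, ((S.toFiber x).map_cc (hp₁₂ i)).trans_le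
    (hle (some i) x (subset_closure hi))⟩
  filter_upwards [(hVo i).mem_nhds hi] with y hy
  exact (hVN i (subset_closure hy)).1

/-! ### The semigroup of continuous sections -/

/-- Every continuous section is the supremum of piecewise characteristic sections, each locally way
below the next: a countable base of the global elements and of the topology yields countably many
local lower bounds that determine the section, and interpolation meets them one by one. -/
theorem exists_approximating_sequence [SecondCountableTopology X] (hS : S.IsSurjective)
    (hdim : smallInductiveDimension X ≤ 1) (hB : CountablyBased S.global) (f : sections hS) :
    ∃ g : ℕ → sections hS, (∀ n, S.IsPiecewiseCharacteristic (g n).1) ∧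
      (∀ n, LocallyBelow (g n).1 (g (n + 1)).1) ∧ (∀ n, LocallyBelow (g n).1 f.1) ∧
      IsLUB (Set.range g) f := by
  obtain ⟨B, hBc, hB⟩ := hB
  -- The local lower bounds of `f` taken from the countable bases; the trivial one is added to make
  -- sure that there is one.
  let D : Set (S.global × S.global × Set X) :=
    {d | d.1 ≪ d.2.1 ∧ ∀ y ∈ closure d.2.2, S.toFiber y d.2.1 ≪ f.1 y}
  let D' : Set (S.global × S.global × Set X) :=
    insert (0, 0, ∅) (D ∩ B ×ˢ B ×ˢ TopologicalSpace.countableBasis X)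
  have hD'D : D' ⊆ D := Set.insert_subset ⟨zero_cc _, by simp⟩ Set.inter_subset_left
  have hD'c : D'.Countable := ((hBc.prod (hBc.prod
    (TopologicalSpace.countable_countableBasis X))).mono Set.inter_subset_right).insert _
  obtain ⟨e, he⟩ := hD'c.exists_eq_range (Set.insert_nonempty _ _)
  have heD : ∀ n, e n ∈ D := fun n => hD'D (he ▸ ⟨n, rfl⟩)
  have hnext : ∀ (n : ℕ) (g : {g : sections hS // LocallyBelow g.1 f.1}),
      ∃ h : {h : sections hS // LocallyBelow h.1 f.1}, S.IsPiecewiseCharacteristic h.1.1 ∧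
        LocallyBelow g.1.1 h.1.1 ∧
        ∀ y ∈ closure (e n).2.2, S.toFiber y (e n).1 ≤ h.1.1 y := by
    intro n g
    obtain ⟨h, hc, hpc, hgh, hhf, hle⟩ := g.2.exists_piecewiseCharacteristic_between hS hdim f.2
      isClosed_closure (heD n).1 (heD n).2
    exact ⟨⟨⟨h, hc⟩, hhf⟩, hpc, hgh, hle⟩
  choose next hpc hlb hle using hnext
  let G : ℕ → {g : sections hS // LocallyBelow g.1 f.1} :=
    fun n => Nat.rec ⟨0, LocallyBelow.zero _⟩ next n
  have hlb' : ∀ n, LocallyBelow (G (n + 1)).1.1 (G (n + 2)).1.1 := fun n => hlb _ _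
  have hmono : Monotone fun n => (G (n + 1)).1 := monotone_nat_of_le_succ fun n => (hlb' n).le
  refine ⟨fun n => (G (n + 1)).1, fun n => hpc _ _, hlb', fun n => (G (n + 1)).2,
    (isLUB_sections_iff hS hmono).2 fun x => ⟨?_, fun c hc => ?_⟩⟩
  · rintro _ ⟨n, rfl⟩
    exact (G (n + 1)).2.le x
  · obtain ⟨ρ, hρ, hρf⟩ := hS.exists_rapid (f.1 x)
    refine hρf.2 ?_
    rintro _ ⟨n, rfl⟩
    obtain ⟨z, hzB, hz, hzρ⟩ := hB (ρ (n + 1))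
    obtain ⟨k, hk⟩ := hρ n _ ((S.toFiber x).monotone.comp hz.monotone) _
      ((S.toFiber x).map_isLUB hz.monotone hzρ) le_rfl
    obtain ⟨U, hU, hxU, hUf⟩ :=
      (TopologicalSpace.isBasis_countableBasis X).exists_closure_subset
        (f.2.eventually (hz (k + 1)) (((S.toFiber x).map_cc (hz.cc hzρ (k + 2))).trans_le
          (hρf.1 ⟨n + 1, rfl⟩)))
    have hmem : (z k, z (k + 1), U) ∈ D' :=
      Set.mem_insert_of_mem _ ⟨⟨hz k, hUf⟩, hzB k, hzB (k + 1), hU⟩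
    rw [he] at hmem
    obtain ⟨m, hm⟩ := hmem
    have hx := hle m (G m) x (by rw [hm]; exact subset_closure hxU)
    rw [hm] at hx
    exact (le_trans hk hx).trans (hc ⟨m, rfl⟩)

theorem isCu_sections [SecondCountableTopology X] (hS : S.IsSurjective)
    (hdim : smallInductiveDimension X ≤ 1) (hB : CountablyBased S.global) :
    IsCu (sections hS) where
  zero_le f x := IsCu.zero_le (f.1 x)
  add_le_add_right f g h hfg x := IsCu.add_le_add_right _ _ (h.1 x) (hfg x)
  exists_isLUB z hz := (exists_isLUB_sections hS hz).imp fun _ h => h.1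
  exists_rapid f := by
    obtain ⟨g, -, hg, -, hl⟩ := exists_approximating_sequence hS hdim hB f
    exact ⟨g, fun n => (hg n).cc hS, hl⟩
  isLUB_add y z hy hz a b ha hb := by
    refine (isLUB_sections_iff hS fun m n h x => IsCu.add_le_add (hy h x) (hz h x)).2 fun x => ?_
    exact IsCu.isLUB_add _ _ (fun m n h => hy h x) (fun m n h => hz h x) _ _
      ((isLUB_sections_iff hS hy).1 ha x) ((isLUB_sections_iff hS hz).1 hb x)
  add_compactlyContained f f' g g' hf hg := by
    have key : ∀ {h h' : sections hS}, h ≪ h' → LocallyBelow h.1 h'.1 := by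
      intro h h' hh
      obtain ⟨p, -, hp, hp', hl⟩ := exists_approximating_sequence hS hdim hB h'
      obtain ⟨n, hn⟩ := hh p (monotone_nat_of_le_succ fun n => (hp n).le) h' hl le_rfl
      exact (hp' n).mono hn
    exact ((key hf).add (key hg)).cc hS

end CuPresheaf

end CuSheaf

theorem mainTheorem6 {X : Type u} [TopologicalSpace X] [CompactSpace X] [T2Space X]
    [SecondCountableTopology X] [Nonempty X] (hdim : smallInductiveDimension X ≤ 1)
    (S : CuSheaf.CuPresheaf.{u, v} X) (hcont : S.IsContinuous) (hsheaf : S.IsSheaf)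
    (hsurj : S.IsSurjective) (hbased : CuSheaf.CountablyBased S.global) :
    ∃ Γ : AddSubmonoid (∀ x, S.Fiber x),
      (∀ f, f ∈ Γ ↔ S.IsContinuousSection f) ∧
      CuSheaf.IsCu Γ ∧
      ∀ f : Γ, ∃ g : ℕ → Γ,
        (∀ n, S.IsPiecewiseCharacteristic (g n).1 ∧ g n ≪ f) ∧
        CuSheaf.RapidlyIncreasing g ∧ IsLUB (Set.range g) f := by
  refine ⟨CuSheaf.CuPresheaf.sections hsurj, fun f => Iff.rfl,
    CuSheaf.CuPresheaf.isCu_sections hsurj hdim hbased, fun f => ?_⟩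
  obtain ⟨g, hpc, hg, hgf, hl⟩ :=
    CuSheaf.CuPresheaf.exists_approximating_sequence hsurj hdim hbased f
  exact ⟨g, fun n => ⟨hpc n, (hgf n).cc hsurj⟩, fun n => (hg n).cc hsurj, hl⟩
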